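/- **Notation.** Let $I=(0,1]$. All nets below are indexed by $\varepsilon\in I$, and $O(\cdot)$ refers to $\varepsilon\to0$. * $\mathcal G(\mathbb R)$ is the Colombeau algebra on $\mathbb R$: nets $(u_\varepsilon)$ of smooth functions such that for every compact $K$ and every derivative $\partial^\alpha$ there is $p$ with $\sup_K|\partial^\alpha u_\varepsilon|=O(\varepsilon^{-p})$, modulo those nets for which $\sup_K|\partial^\alpha u_\varepsilon|=O(\varepsilon^{q})$ for all $K$, $\alpha$ and all $q$. * $\mathcal G_\tau(\mathbb R^n)$ is the algebra of tempered generalized functions: nets of slowly increasing smooth functions such that for every $\alpha$ there is $p$ with $\sup_{x\in\mathbb R^n}(1+|x|)^{-p}|\partial^\alpha u_\varepsilon(x)|=O(\varepsilon^{-p})$, modulo those nets such that for every $\alpha$ there is $p$ with $\sup_{x\in\mathbb R^n}(1+|x|)^{-p}|\partial^\alpha u_\varepsilon(x)|=O(\varepsilon^{q})$ for all $q$. * $\widetilde{\mathcal G}_\tau(\mathbb R^m\times\mathbb R^n)$ (written $\widetilde{\mathcal G}_\tau(\mathbb R^{1+n})$ for $m=1$) is defined in the same way as $\mathcal G_\tau$,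 with the suprema of $(1+|x|)^{-p}|\partial^\alpha u_\varepsilon(\eta,x)|$ taken over $(\eta,x)\in K\times\mathbb R^n$ for each compact $K\subset\mathbb R^m$, the exponent $p$ being allowed to depend on $K$ and $\alpha$; the members of the nets are smooth, with every derivative of at most polynomial growth in $x$, locally uniformly in $\eta$. * $\mathcal R$ is the ring of generalized numbers: nets in $\mathbb R$ that are $O(\varepsilon^{-p})$ for some $p$, modulo those that are $O(\varepsilon^q)$ for all $q$. Elements of $\mathcal R^n$ are called generalized points. Compositions, derivatives and values at generalized points are defined componentwise in $\varepsilon$. A *generalized group action* on $\mathbb R^n$ is a $\Phi\in(\widetilde{\mathcal G}_\tau(\mathbb R^{1+n}))^n$ with $\Phi(0,\cdot)=\mathrm{id}$ in $(\mathcal G_\tau(\mathbb R^n))^n$ and $\Phi(\eta_1+\eta_2,\cdot)=\Phi(\eta_1,\Phi(\eta_2,\cdot))$ in $(\widetilde{\mathcal G}_\tau(\mathbb R^{2}\times\mathbb R^{n}))^n$. A generalized vector field $X=\sum_j\xi_j(x)\partial_{x_j}$, $\xi\in(\mathcal G_\tau(\mathbb R^n))^n$, is *$\mathcal G$-complete*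 if for all $\tilde x_0\in\mathcal R^n$ and $t_0\in\mathbb R$ the problem $\dot x(t)=\xi(x(t))$, $x(t_0)=\tilde x_0$ has exactly one solution in $\mathcal G(\mathbb R)^n$. $\Phi$ is called *$\mathcal G$-complete*, with *infinitesimal generator* $X$, if the vector field $X$ with $\xi=\frac{d}{d\eta}\big|_0\Phi(\eta,\cdot)$ is $\mathcal G$-complete. For $F\in\mathcal G_\tau(\mathbb R^n)$, $\Phi$ is a *symmetry group* of the equation $F(x)=0$ if for every $\tilde x\in\mathcal R^n$ with $F(\tilde x)=0$ in $\mathcal R$ one has $F(\Phi(\cdot,\tilde x))=0$ in $\mathcal G(\mathbb R)$. Finally $X(F)=\sum_j\xi_j\,\partial_jF\in\mathcal G_\tau(\mathbb R^n)$. **Theorem 4.7.** Let $n\ge1$, $1\le i\le n$, $f\in\mathcal G_\tau(\mathbb R^{n-1})$, write $x'=(x_1,\dots,x_{i-1},x_{i+1},\dots,x_n)$, and let $F\in\mathcal G_\tau(\mathbb R^n)$ be $F(x)=x_i-f(x')$. Let $\Phi$ be a $\mathcal G$-complete generalized group action on $\mathbb R^n$ with infinitesimal generator $X=\sum_{j=1}^n\xi_j(x)\partial_{x_j}$.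 Write $(x',f(x'))$ for the point of the graph of $f$ whose $i$-th coordinate is $f(x')$ and whose other coordinates are given by $x'$. Suppose that the generalized vector field $x'\mapsto(\xi_j(x',f(x')))_{j\ne i}$ on $\mathbb R^{n-1}$ possesses a flow in $(\widetilde{\mathcal G}_\tau(\mathbb R^{1+(n-1)}))^{n-1}$, that is, there is $h\in(\widetilde{\mathcal G}_\tau(\mathbb R^{1+(n-1)}))^{n-1}$ such that for every $\tilde a'\in\mathcal R^{n-1}$ the curve $x'(\eta)=h(\eta,\tilde a')$ in $\mathcal G(\mathbb R)^{n-1}$ satisfies $\dot x_j=\xi_j(x',f(x'))$ for $j\neq i$ and $x'(0)=\tilde a'$. Then the following are equivalent: 1. $\Phi$ is a symmetry group of $F(x)=0$. 2. For every $\tilde x\in\mathcal R^n$ with $F(\tilde x)=0$ in $\mathcal R$, one has $X(F)(\tilde x)=0$ in $\mathcal R$. -/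

import Mathlib

open Filter Topology
open scoped ContDiff

namespace Colombeau

/-- The index set `I = (0, 1]`. -/
abbrev Idx : Type := Set.Ioc (0 : ℝ) 1

/-- The limit `ε → 0` in the index set `I = (0, 1]`. -/
def epsToZero : Filter Idx := comap (fun ε : Idx => (ε : ℝ)) (𝓝 0)

/-- The type of the growth conditions of a Colombeau algebra on `D`: the sets on which the
suprema are taken, and the quantity whose powers these suprema are weighted with. -/
structure Growth (D : Type) [NormedAddCommGroup D] where
  sets : Set (Set D)
  weight : D → ℝ
  weight_nonneg : ∀ x, 0 ≤ weight x
  weight_le_norm : ∀ x, weight x ≤ ‖x‖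

/-- The growth type of `𝒢(E)`: suprema over compact sets, without weight. -/
def growthG (E : Type) [NormedAddCommGroup E] : Growth E where
  sets := {K | IsCompact K}
  weight := fun _ => 0
  weight_nonneg := fun _ => le_rfl
  weight_le_norm := fun x => norm_nonneg x

/-- The growth type of `𝒢_τ(H)`: suprema over the whole space, weighted by powers of
`1 + |x|`. -/
def growthTau (H : Type) [NormedAddCommGroup H] : Growth H where
  sets := {Set.univ}
  weight := fun x => ‖x‖
  weight_nonneg := fun x => norm_nonneg x
  weight_le_norm := fun _ => le_rfl

/-- The growth type of `𝒢̃_τ(E × H)`: suprema over the sets `K × H` with `K` compact in `E`,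
weighted by powers of `1 + |y|` for `(x, y) ∈ E × H`. -/
def growthMixed (E H : Type) [NormedAddCommGroup E] [NormedAddCommGroup H] :
    Growth (E × H) where
  sets := {S | ∃ K : Set E, IsCompact K ∧ S = K ×ˢ Set.univ}
  weight := fun z => ‖z.2‖
  weight_nonneg := fun z => norm_nonneg z.2
  weight_le_norm := fun z => norm_snd_le z

section Nets

variable {D : Type} [NormedAddCommGroup D] [NormedSpace ℝ D]
variable {V : Type} [NormedAddCommGroup V] [NormedSpace ℝ V]

/-- The bound `sup_{x ∈ S} (1 + w x)^{-p} b_ε(x) = O(ε^{-p})` for some `p`. -/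
def ModBound (g : Growth D) (S : Set D) (b : Idx → D → ℝ) : Prop :=
  ∃ (p : ℕ) (C : ℝ), ∀ᶠ ε in epsToZero, ∀ x ∈ S,
    b ε x ≤ C * ((ε : ℝ)⁻¹) ^ p * (1 + g.weight x) ^ p

/-- The bound `sup_{x ∈ S} (1 + w x)^{-p} b_ε(x) = O(ε^q)` for some `p` and all `q`. -/
def NegBound (g : Growth D) (S : Set D) (b : Idx → D → ℝ) : Prop :=
  ∃ p : ℕ, ∀ q : ℕ, ∃ C : ℝ, ∀ᶠ ε in epsToZero, ∀ x ∈ S,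
    b ε x ≤ C * (ε : ℝ) ^ q * (1 + g.weight x) ^ p

/-- The smooth functions that may occur as members of a net. For the growth type of `𝒢_τ` these
are the slowly increasing functions `𝒪_M`; for that of `𝒢` they are all the smooth functions;
in the mixed case they are slowly increasing in the second variable, locally uniformly in the
first one. -/
def SlowlyIncreasing (g : Growth D) (f : D → V) : Prop :=
  ContDiff ℝ ∞ f ∧ ∀ S ∈ g.sets, ∀ k : ℕ, ∃ (p : ℕ) (C : ℝ), ∀ x ∈ S,
    ‖iteratedFDeriv ℝ k f x‖ ≤ C * (1 + g.weight x) ^ p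

/-- All derivatives of the net have moderate bounds. -/
def IsModerate (g : Growth D) (u : Idx → D → V) : Prop :=
  (∀ ε, SlowlyIncreasing g (u ε)) ∧
    ∀ S ∈ g.sets, ∀ k : ℕ, ModBound g S fun ε x => ‖iteratedFDeriv ℝ k (u ε) x‖

/-- All derivatives of the net have negligible bounds. -/
def IsNegligible (g : Growth D) (u : Idx → D → V) : Prop :=
  (∀ ε, SlowlyIncreasing g (u ε)) ∧
    ∀ S ∈ g.sets, ∀ k : ℕ, NegBound g S fun ε x => ‖iteratedFDeriv ℝ k (u ε) x‖

end Nets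

/-! ### Calculus of the bounds -/

instance : epsToZero.NeBot := by
  unfold epsToZero
  rw [comap_neBot_iff]
  intro t ht
  obtain ⟨r, hr, hrt⟩ := Metric.mem_nhds_iff.1 ht
  refine ⟨⟨min 1 (r / 2), by positivity, min_le_left _ _⟩, hrt ?_⟩
  have h0 : (0 : ℝ) < min 1 (r / 2) := by positivity
  rw [Metric.mem_ball, Real.dist_eq, sub_zero, abs_of_pos h0]
  exact lt_of_le_of_lt (min_le_right _ _) (by linarith)

theorem one_le_inv (ε : Idx) : (1 : ℝ) ≤ (ε : ℝ)⁻¹ := (one_le_inv₀ ε.2.1).2 ε.2.2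

section Bounds

variable {D : Type} [NormedAddCommGroup D] {g : Growth D} {S : Set D} {b c : Idx → D → ℝ}

theorem Growth.one_le (g : Growth D) (x : D) : 1 ≤ 1 + g.weight x := by
  linarith [g.weight_nonneg x]

theorem ModBound.mono (hc : ModBound g S c)
    (h : ∀ᶠ ε in epsToZero, ∀ x ∈ S, b ε x ≤ c ε x) : ModBound g S b := by
  obtain ⟨p, C, hC⟩ := hc
  refine ⟨p, C, ?_⟩
  filter_upwards [hC, h] with ε h1 h2 x hx using (h2 x hx).trans (h1 x hx)

theorem NegBound.mono (hc : NegBound g S c)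
    (h : ∀ᶠ ε in epsToZero, ∀ x ∈ S, b ε x ≤ c ε x) : NegBound g S b := by
  obtain ⟨p, hp⟩ := hc
  refine ⟨p, fun q => ?_⟩
  obtain ⟨C, hC⟩ := hp q
  refine ⟨C, ?_⟩
  filter_upwards [hC, h] with ε h1 h2 x hx using (h2 x hx).trans (h1 x hx)

theorem ModBound.const (r : ℝ) : ModBound g S fun _ _ => r :=
  ⟨0, r, Eventually.of_forall fun ε x _ => by simp⟩

theorem ModBound.weight : ModBound g S fun _ x => g.weight x :=
  ⟨1, 1, Eventually.of_forall fun ε x _ => by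
    have h1 := one_le_inv ε
    have h2 := g.one_le x
    nlinarith⟩

theorem ModBound.add (hb : ModBound g S b) (hc : ModBound g S c) :
    ModBound g S fun ε x => b ε x + c ε x := by
  obtain ⟨p, C, hC⟩ := hb
  obtain ⟨p', C', hC'⟩ := hc
  refine ⟨p + p', |C| + |C'|, ?_⟩
  filter_upwards [hC, hC'] with ε h1 h2 x hx
  have e1 : ∀ n, (1 : ℝ) ≤ (ε : ℝ)⁻¹ ^ n := fun n => one_le_pow₀ (one_le_inv ε)
  have e2 : ∀ n, (1 : ℝ) ≤ (1 + g.weight x) ^ n := fun n => one_le_pow₀ (g.one_le x)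
  have k1 : b ε x ≤ |C| * (ε : ℝ)⁻¹ ^ (p + p') * (1 + g.weight x) ^ (p + p') := by
    refine (h1 x hx).trans ?_
    have := le_abs_self C
    have := e1 p
    have := e2 p
    have := one_le_inv ε
    have := g.one_le x
    gcongr
    all_goals linarith
  have k2 : c ε x ≤ |C'| * (ε : ℝ)⁻¹ ^ (p + p') * (1 + g.weight x) ^ (p + p') := by
    refine (h2 x hx).trans ?_
    have := le_abs_self C'
    have := e1 p'
    have := e2 p'
    have := one_le_inv ε
    have := g.one_le x
    gcongr
    all_goals linarith
  calc b ε x + c ε x ≤ _ := add_le_add k1 k2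
    _ = _ := by ring

theorem ModBound.mul (hb : ModBound g S b) (hc : ModBound g S c) (hb0 : ∀ ε x, 0 ≤ b ε x)
    (hc0 : ∀ ε x, 0 ≤ c ε x) : ModBound g S fun ε x => b ε x * c ε x := by
  obtain ⟨p, C, hC⟩ := hb
  obtain ⟨p', C', hC'⟩ := hc
  refine ⟨p + p', C * C', ?_⟩
  filter_upwards [hC, hC'] with ε h1 h2 x hx
  calc b ε x * c ε x ≤ _ := mul_le_mul (h1 x hx) (h2 x hx) (hc0 ε x) ((hb0 ε x).trans (h1 x hx))
    _ = _ := by ring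

theorem NegBound.mul (hb : NegBound g S b) (hc : ModBound g S c) (hb0 : ∀ ε x, 0 ≤ b ε x)
    (hc0 : ∀ ε x, 0 ≤ c ε x) : NegBound g S fun ε x => b ε x * c ε x := by
  obtain ⟨p, hp⟩ := hb
  obtain ⟨p', C', hC'⟩ := hc
  refine ⟨p + p', fun q => ?_⟩
  obtain ⟨C, hC⟩ := hp (q + p')
  refine ⟨C * C', ?_⟩
  filter_upwards [hC, hC'] with ε h1 h2 x hx
  have hε : (ε : ℝ) ≠ 0 := ε.2.1.ne'
  calc b ε x * c ε x ≤ _ := mul_le_mul (h1 x hx) (h2 x hx) (hc0 ε x) ((hb0 ε x).trans (h1 x hx))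
    _ = C * C' * (ε : ℝ) ^ q * ((ε : ℝ) ^ p' * (ε : ℝ)⁻¹ ^ p') * (1 + g.weight x) ^ (p + p') := by
      ring
    _ = _ := by rw [← mul_pow, mul_inv_cancel₀ hε]; ring

theorem NegBound.zero : NegBound g S fun _ _ => 0 :=
  ⟨0, fun q => ⟨0, Eventually.of_forall fun ε x _ => by simp⟩⟩

theorem NegBound.add (hb : NegBound g S b) (hc : NegBound g S c) :
    NegBound g S fun ε x => b ε x + c ε x := by
  obtain ⟨p, hp⟩ := hb
  obtain ⟨p', hp'⟩ := hc
  refine ⟨p + p', fun q => ?_⟩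
  obtain ⟨C, hC⟩ := hp q
  obtain ⟨C', hC'⟩ := hp' q
  refine ⟨|C| + |C'|, ?_⟩
  filter_upwards [hC, hC'] with ε h1 h2 x hx
  have e1 : (0 : ℝ) ≤ (ε : ℝ) ^ q := pow_nonneg ε.2.1.le q
  have e2 : ∀ n, (1 : ℝ) ≤ (1 + g.weight x) ^ n := fun n => one_le_pow₀ (g.one_le x)
  have k1 : b ε x ≤ |C| * (ε : ℝ) ^ q * (1 + g.weight x) ^ (p + p') := by
    refine (h1 x hx).trans ?_
    have := le_abs_self C
    have := e2 p
    have := g.one_le x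
    gcongr; linarith
  have k2 : c ε x ≤ |C'| * (ε : ℝ) ^ q * (1 + g.weight x) ^ (p + p') := by
    refine (h2 x hx).trans ?_
    have := le_abs_self C'
    have := e2 p'
    have := g.one_le x
    gcongr; linarith
  calc b ε x + c ε x ≤ _ := add_le_add k1 k2
    _ = _ := by ring

theorem ModBound.sum {ι : Type} (s : Finset ι) (f : ι → Idx → D → ℝ)
    (h : ∀ i ∈ s, ModBound g S (f i)) : ModBound g S fun ε x => ∑ i ∈ s, f i ε x := by
  classical
  induction s using Finset.induction_on with
  | empty => simpa using ModBound.const 0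
  | insert a s ha ih =>
    simp only [Finset.sum_insert ha]
    exact (h a (by simp)).add (ih fun i hi => h i (by simp [hi]))

theorem NegBound.sum {ι : Type} (s : Finset ι) (f : ι → Idx → D → ℝ)
    (h : ∀ i ∈ s, NegBound g S (f i)) : NegBound g S fun ε x => ∑ i ∈ s, f i ε x := by
  classical
  induction s using Finset.induction_on with
  | empty => simpa using NegBound.zero
  | insert a s ha ih =>
    simp only [Finset.sum_insert ha]
    exact (h a (by simp)).add (ih fun i hi => h i (by simp [hi]))

theorem ModBound.pow (hb : ModBound g S b) (hb0 : ∀ ε x, 0 ≤ b ε x) (n : ℕ) :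
    ModBound g S fun ε x => b ε x ^ n := by
  induction n with
  | zero => simpa using ModBound.const 1
  | succ n ih =>
    simp only [pow_succ]
    exact ih.mul hb (fun ε x => pow_nonneg (hb0 ε x) n) hb0

/-- Insertion of a moderate net into a moderate bound. -/
theorem ModBound.comp {D' : Type} [NormedAddCommGroup D'] {g' : Growth D'} {T : Set D'}
    {c : Idx → D' → ℝ} (hc : ModBound g' T c) {m : Idx → D → ℝ} (hm : ModBound g S m)
    (hm0 : ∀ ε x, 0 ≤ m ε x) (hb : ∀ ε, ∀ x ∈ S, ∃ y ∈ T, g'.weight y ≤ m ε x ∧ b ε x ≤ c ε y) :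
    ModBound g S b := by
  obtain ⟨p, C, hC⟩ := hc
  have e : ModBound g S fun ε _ => (ε : ℝ)⁻¹ ^ p := by
    refine ⟨p, 1, Eventually.of_forall fun ε x _ => ?_⟩
    have h1 : (1 : ℝ) ≤ (ε : ℝ)⁻¹ ^ p := one_le_pow₀ (one_le_inv ε)
    have h2 : (1 : ℝ) ≤ (1 + g.weight x) ^ p := one_le_pow₀ (g.one_le x)
    nlinarith
  have h1 : ∀ ε x, 0 ≤ 1 + m ε x := fun ε x => by linarith [hm0 ε x]
  have hi : ∀ ε : Idx, 0 ≤ (ε : ℝ)⁻¹ := fun ε => zero_le_one.trans (one_le_inv ε)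
  refine (((ModBound.const |C|).mul e (fun _ _ => abs_nonneg C)
    fun ε x => pow_nonneg (hi ε) p).mul (((ModBound.const 1).add hm).pow h1 p)
    (fun ε x => mul_nonneg (abs_nonneg C) (pow_nonneg (hi ε) p))
    fun ε x => pow_nonneg (h1 ε x) p).mono ?_
  filter_upwards [hC] with ε hε x hx
  obtain ⟨y, hy, hw, hbc⟩ := hb ε x hx
  refine (hbc.trans (hε y hy)).trans ?_
  have := hi ε
  have := g'.weight_nonneg y
  have := le_abs_self C
  gcongr

/-- Insertion of a moderate net into a negligible bound. -/
theorem NegBound.comp {D' : Type} [NormedAddCommGroup D'] {g' : Growth D'} {T : Set D'}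
    {c : Idx → D' → ℝ} (hc : NegBound g' T c) {m : Idx → D → ℝ} (hm : ModBound g S m)
    (hm0 : ∀ ε x, 0 ≤ m ε x) (hb : ∀ ε, ∀ x ∈ S, ∃ y ∈ T, g'.weight y ≤ m ε x ∧ b ε x ≤ c ε y) :
    NegBound g S b := by
  obtain ⟨p, hp⟩ := hc
  have h1 : ∀ ε x, 0 ≤ 1 + m ε x := fun ε x => by linarith [hm0 ε x]
  obtain ⟨p', C', hM⟩ := ((ModBound.const 1).add hm).pow (g := g) (S := S) h1 p
  refine ⟨p', fun q => ?_⟩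
  obtain ⟨C, hC⟩ := hp (q + p')
  refine ⟨|C| * C', ?_⟩
  filter_upwards [hC, hM] with ε hε hε' x hx
  obtain ⟨y, hy, hw, hbc⟩ := hb ε x hx
  have hε0 : (0 : ℝ) < ε := ε.2.1
  have := g'.weight_nonneg y
  have := le_abs_self C
  calc b ε x ≤ C * (ε : ℝ) ^ (q + p') * (1 + g'.weight y) ^ p := hbc.trans (hε y hy)
    _ ≤ |C| * (ε : ℝ) ^ (q + p') * (1 + m ε x) ^ p := by gcongr
    _ ≤ |C| * (ε : ℝ) ^ (q + p') * (C' * (ε : ℝ)⁻¹ ^ p' * (1 + g.weight x) ^ p') := by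
      gcongr
      exact hε' x hx
    _ = |C| * C' * (ε : ℝ) ^ q * ((ε : ℝ) ^ p' * (ε : ℝ)⁻¹ ^ p') * (1 + g.weight x) ^ p' := by
      ring
    _ = _ := by rw [← mul_pow, mul_inv_cancel₀ hε0.ne']; ring

end Bounds

/-! ### Stability of the bounds under the operations on nets -/

section Stability

variable {D : Type} [NormedAddCommGroup D] [NormedSpace ℝ D] {g : Growth D} {S : Set D}
variable {D' : Type} [NormedAddCommGroup D'] [NormedSpace ℝ D'] {g' : Growth D'} {T : Set D'}
variable {V : Type} [NormedAddCommGroup V] [NormedSpace ℝ V]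
variable {V₁ : Type} [NormedAddCommGroup V₁] [NormedSpace ℝ V₁]
variable {V₂ : Type} [NormedAddCommGroup V₂] [NormedSpace ℝ V₂]

theorem slowlyIncreasing_iff {f : D → V} : SlowlyIncreasing g f ↔
    ContDiff ℝ ∞ f ∧ ∀ S ∈ g.sets, ∀ k : ℕ,
      ModBound g S fun _ x => ‖iteratedFDeriv ℝ k f x‖ := by
  refine and_congr_right fun _ => forall₃_congr fun S hS k => ?_
  constructor
  · rintro ⟨p, C, h⟩
    refine ⟨p, |C|, Eventually.of_forall fun ε x hx => (h x hx).trans ?_⟩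
    have h1 : (1 : ℝ) ≤ (ε : ℝ)⁻¹ ^ p := one_le_pow₀ (one_le_inv ε)
    have h2 : C ≤ |C| * (ε : ℝ)⁻¹ ^ p := by nlinarith [le_abs_self C, abs_nonneg C]
    exact mul_le_mul_of_nonneg_right h2 (pow_nonneg (zero_le_one.trans (g.one_le x)) p)
  · rintro ⟨p, C, h⟩
    obtain ⟨ε, hε⟩ := h.exists
    exact ⟨p, _, hε⟩

theorem IsModerate.contDiff {u : Idx → D → V} (h : IsModerate g u) (ε : Idx) :
    ContDiff ℝ ∞ (u ε) := (h.1 ε).1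

theorem modBound_bilin (B : V₁ →L[ℝ] V₂ →L[ℝ] V) {u : Idx → D → V₁} {v : Idx → D → V₂}
    (hu : ∀ ε, ContDiff ℝ ∞ (u ε)) (hv : ∀ ε, ContDiff ℝ ∞ (v ε)) (k : ℕ)
    (hu' : ∀ j ≤ k, ModBound g S fun ε x => ‖iteratedFDeriv ℝ j (u ε) x‖)
    (hv' : ∀ j ≤ k, ModBound g S fun ε x => ‖iteratedFDeriv ℝ j (v ε) x‖) :
    ModBound g S fun ε x => ‖iteratedFDeriv ℝ k (fun y => B (u ε y) (v ε y)) x‖ := by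
  have key := (ModBound.const (g := g) (S := S) ‖B‖).mul (ModBound.sum (Finset.range (k + 1))
    (fun i ε x => (k.choose i : ℝ) * ‖iteratedFDeriv ℝ i (u ε) x‖ *
      ‖iteratedFDeriv ℝ (k - i) (v ε) x‖) fun i hi =>
      (((ModBound.const (k.choose i : ℝ)).mul (hu' i (Nat.lt_succ_iff.1 (Finset.mem_range.1 hi)))
        (fun _ _ => by positivity) fun _ _ => by positivity).mul (hv' (k - i) (Nat.sub_le k i))
        (fun _ _ => by positivity) fun _ _ => by positivity))
    (fun _ _ => by positivity) fun _ _ => by positivity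
  exact key.mono (Eventually.of_forall fun ε x _ =>
    B.norm_iteratedFDeriv_le_of_bilinear (hu ε) (hv ε) x (mod_cast le_top))

theorem negBound_bilin (B : V₁ →L[ℝ] V₂ →L[ℝ] V) {u : Idx → D → V₁} {v : Idx → D → V₂}
    (hu : ∀ ε, ContDiff ℝ ∞ (u ε)) (hv : ∀ ε, ContDiff ℝ ∞ (v ε)) (k : ℕ)
    (hu' : ∀ j ≤ k, NegBound g S fun ε x => ‖iteratedFDeriv ℝ j (u ε) x‖)
    (hv' : ∀ j ≤ k, ModBound g S fun ε x => ‖iteratedFDeriv ℝ j (v ε) x‖) :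
    NegBound g S fun ε x => ‖iteratedFDeriv ℝ k (fun y => B (u ε y) (v ε y)) x‖ := by
  have key := (NegBound.sum (Finset.range (k + 1))
    (fun i ε x => ‖iteratedFDeriv ℝ i (u ε) x‖ * ((k.choose i : ℝ) * ‖B‖) *
      ‖iteratedFDeriv ℝ (k - i) (v ε) x‖) fun i hi =>
      (((hu' i (Nat.lt_succ_iff.1 (Finset.mem_range.1 hi))).mul (ModBound.const _)
        (fun _ _ => by positivity) fun _ _ => by positivity).mul (hv' (k - i) (Nat.sub_le k i))
        (fun _ _ => by positivity) fun _ _ => by positivity))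
  refine key.mono (Eventually.of_forall fun ε x _ =>
    (B.norm_iteratedFDeriv_le_of_bilinear (hu ε) (hv ε) x (n := k) (mod_cast le_top)).trans
      (le_of_eq ?_))
  rw [Finset.mul_sum]
  exact Finset.sum_congr rfl fun i _ => by ring

theorem modBound_comp {u : Idx → D' → V} {a : Idx → D → D'} (hu : ∀ ε, ContDiff ℝ ∞ (u ε))
    (ha : ∀ ε, ContDiff ℝ ∞ (a ε)) (haT : ∀ ε, ∀ x ∈ S, a ε x ∈ T) (k : ℕ)
    (hu' : ∀ j, ModBound g' T fun ε x => ‖iteratedFDeriv ℝ j (u ε) x‖)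
    (ha' : ∀ j, ModBound g S fun ε x => ‖iteratedFDeriv ℝ j (a ε) x‖) :
    ModBound g S fun ε x => ‖iteratedFDeriv ℝ k (fun y => u ε (a ε y)) x‖ := by
  have hM := (ModBound.sum (Finset.range (k + 1)) _ fun j _ => hu' j).comp (ha' 0)
    (b := fun ε x => ∑ j ∈ Finset.range (k + 1), ‖iteratedFDeriv ℝ j (u ε) (a ε x)‖)
    (fun _ _ => norm_nonneg _) fun ε x hx => ⟨a ε x, haT ε x hx, by
      rw [norm_iteratedFDeriv_zero]; exact g'.weight_le_norm _, le_rfl⟩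
  have hB := ((ModBound.const 1).add (ModBound.sum (Finset.range (k + 1)) _ fun j _ => ha' j)).pow
    (fun ε x => by positivity) k
  have key := (((ModBound.const (k.factorial : ℝ)).mul hM (fun _ _ => by positivity)
    fun _ _ => by positivity).mul hB (fun _ _ => by positivity) fun _ _ => by positivity)
  refine key.mono (Eventually.of_forall fun ε x _ => ?_)
  refine norm_iteratedFDeriv_comp_le (hu ε) (ha ε) (n := k) (mod_cast le_top) x (fun j hj => ?_)
    fun j h1 hj => ?_
  · exact Finset.single_le_sum (f := fun j => ‖iteratedFDeriv ℝ j (u ε) (a ε x)‖)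
      (fun _ _ => norm_nonneg _) (Finset.mem_range.2 (Nat.lt_succ_iff.2 hj))
  · have h2 := Finset.single_le_sum (f := fun j => ‖iteratedFDeriv ℝ j (a ε) x‖)
      (fun _ _ => norm_nonneg _) (Finset.mem_range.2 (Nat.lt_succ_iff.2 hj))
    have h3 : (1 : ℝ) ≤ 1 + ∑ j ∈ Finset.range (k + 1), ‖iteratedFDeriv ℝ j (a ε) x‖ :=
      le_add_of_nonneg_right (Finset.sum_nonneg fun _ _ => norm_nonneg _)
    exact (h2.trans (by linarith)).trans (le_self_pow₀ h3 (by omega))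

theorem negBound_comp {u : Idx → D' → V} {a : Idx → D → D'} (hu : ∀ ε, ContDiff ℝ ∞ (u ε))
    (ha : ∀ ε, ContDiff ℝ ∞ (a ε)) (haT : ∀ ε, ∀ x ∈ S, a ε x ∈ T) (k : ℕ)
    (hu' : ∀ j, NegBound g' T fun ε x => ‖iteratedFDeriv ℝ j (u ε) x‖)
    (ha' : ∀ j, ModBound g S fun ε x => ‖iteratedFDeriv ℝ j (a ε) x‖) :
    NegBound g S fun ε x => ‖iteratedFDeriv ℝ k (fun y => u ε (a ε y)) x‖ := by
  have hM := (NegBound.sum (Finset.range (k + 1)) _ fun j _ => hu' j).comp (ha' 0)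
    (b := fun ε x => ∑ j ∈ Finset.range (k + 1), ‖iteratedFDeriv ℝ j (u ε) (a ε x)‖)
    (fun _ _ => norm_nonneg _) fun ε x hx => ⟨a ε x, haT ε x hx, by
      rw [norm_iteratedFDeriv_zero]; exact g'.weight_le_norm _, le_rfl⟩
  have hB := ((ModBound.const 1).add (ModBound.sum (Finset.range (k + 1)) _ fun j _ => ha' j)).pow
    (fun ε x => by positivity) k
  have key := ((hM.mul (ModBound.const (k.factorial : ℝ)) (fun _ _ => by positivity)
    fun _ _ => by positivity).mul hB (fun _ _ => by positivity) fun _ _ => by positivity)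
  refine key.mono (Eventually.of_forall fun ε x _ => ?_)
  rw [mul_comm (∑ j ∈ Finset.range (k + 1), ‖iteratedFDeriv ℝ j (u ε) (a ε x)‖)]
  refine norm_iteratedFDeriv_comp_le (hu ε) (ha ε) (n := k) (mod_cast le_top) x (fun j hj => ?_)
    fun j h1 hj => ?_
  · exact Finset.single_le_sum (f := fun j => ‖iteratedFDeriv ℝ j (u ε) (a ε x)‖)
      (fun _ _ => norm_nonneg _) (Finset.mem_range.2 (Nat.lt_succ_iff.2 hj))
  · have h2 := Finset.single_le_sum (f := fun j => ‖iteratedFDeriv ℝ j (a ε) x‖)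
      (fun _ _ => norm_nonneg _) (Finset.mem_range.2 (Nat.lt_succ_iff.2 hj))
    have h3 : (1 : ℝ) ≤ 1 + ∑ j ∈ Finset.range (k + 1), ‖iteratedFDeriv ℝ j (a ε) x‖ :=
      le_add_of_nonneg_right (Finset.sum_nonneg fun _ _ => norm_nonneg _)
    exact (h2.trans (by linarith)).trans (le_self_pow₀ h3 (by omega))

theorem exists_mem_segment {f : D' → V} (hf : ContDiff ℝ ∞ f) (y z : D') :
    ∃ w ∈ segment ℝ y z, ‖f y - f z‖ ≤ ‖fderiv ℝ f w‖ * ‖y - z‖ := by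
  have hc : IsCompact (segment ℝ y z) := by
    rw [segment_eq_image_lineMap]
    exact isCompact_Icc.image (AffineMap.lineMap_continuous)
  obtain ⟨w, hw, hmax⟩ := hc.exists_isMaxOn ⟨y, left_mem_segment ℝ y z⟩
    (f := fun w => ‖fderiv ℝ f w‖) (hf.continuous_fderiv (by simp)).norm.continuousOn
  exact ⟨w, hw, (convex_segment y z).norm_image_sub_le_of_norm_fderiv_le
    (fun x _ => (hf.differentiable (by simp)) x) (fun x hx => hmax hx)
    (right_mem_segment ℝ y z) (left_mem_segment ℝ y z)⟩

theorem negBound_comp_sub (hT : Convex ℝ T) {a b : Idx → D → D'}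
    (ha : ∀ ε, ContDiff ℝ ∞ (a ε)) (hb : ∀ ε, ContDiff ℝ ∞ (b ε))
    (haT : ∀ ε, ∀ x ∈ S, a ε x ∈ T) (hbT : ∀ ε, ∀ x ∈ S, b ε x ∈ T)
    (ha' : ∀ j, ModBound g S fun ε x => ‖iteratedFDeriv ℝ j (a ε) x‖)
    (hb' : ∀ j, ModBound g S fun ε x => ‖iteratedFDeriv ℝ j (b ε) x‖)
    (hab : ∀ j, NegBound g S fun ε x => ‖iteratedFDeriv ℝ j (fun y => a ε y - b ε y) x‖)
    (k : ℕ) : ∀ {V : Type} [NormedAddCommGroup V] [NormedSpace ℝ V] {u : Idx → D' → V},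
    (∀ ε, ContDiff ℝ ∞ (u ε)) →
    (∀ j, ModBound g' T fun ε x => ‖iteratedFDeriv ℝ j (u ε) x‖) →
    NegBound g S fun ε x =>
      ‖iteratedFDeriv ℝ k (fun y => u ε (a ε y) - u ε (b ε y)) x‖ := by
  induction k using Nat.strong_induction_on with
  | _ k ih =>
    intro V _ _ u hu hu'
    have hdu : ∀ ε, ContDiff ℝ ∞ (fderiv ℝ (u ε)) := fun ε => (hu ε).fderiv_right (by simp)
    have hdu' : ∀ j, ModBound g' T fun ε x => ‖iteratedFDeriv ℝ j (fderiv ℝ (u ε)) x‖ := by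
      intro j
      simpa only [norm_iteratedFDeriv_fderiv] using hu' (j + 1)
    cases k with
    | zero =>
      choose w hw hw' using fun (ε : Idx) (x : D) => exists_mem_segment (hu ε) (a ε x) (b ε x)
      have hsum := ((ha' 0).add (hb' 0))
      have h1 := (hdu' 0).comp hsum (b := fun ε x => ‖fderiv ℝ (u ε) (w ε x)‖)
        (fun _ _ => by positivity) fun ε x hx => ⟨w ε x,
          hT.segment_subset (haT ε x hx) (hbT ε x hx) (hw ε x), by
            refine (g'.weight_le_norm _).trans ?_
            simp only [norm_iteratedFDeriv_zero]
            obtain ⟨s, t, hs, ht, hst, hh⟩ := hw ε x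
            rw [← hh]
            refine (norm_add_le _ _).trans ?_
            rw [norm_smul, norm_smul, Real.norm_of_nonneg hs, Real.norm_of_nonneg ht]
            have := norm_nonneg (a ε x)
            have := norm_nonneg (b ε x)
            nlinarith, by rw [norm_iteratedFDeriv_zero]⟩
      refine ((hab 0).mul h1 (fun _ _ => by positivity) fun _ _ => by positivity).mono
        (Eventually.of_forall fun ε x _ => ?_)
      rw [norm_iteratedFDeriv_zero, norm_iteratedFDeriv_zero, mul_comm]
      exact hw' ε x
    | succ k =>
      have hda : ∀ ε, ContDiff ℝ ∞ (fderiv ℝ (a ε)) := fun ε => (ha ε).fderiv_right (by simp)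
      have hdb : ∀ ε, ContDiff ℝ ∞ (fderiv ℝ (b ε)) := fun ε => (hb ε).fderiv_right (by simp)
      have e : ∀ ε, fderiv ℝ (fun y => u ε (a ε y) - u ε (b ε y)) = fun y =>
          ContinuousLinearMap.compL ℝ D D' V (fderiv ℝ (u ε) (a ε y) - fderiv ℝ (u ε) (b ε y))
            (fderiv ℝ (a ε) y) +
          ContinuousLinearMap.compL ℝ D D' V (fderiv ℝ (u ε) (b ε y))
            (fderiv ℝ (fun y => a ε y - b ε y) y) := by
        intro ε
        funext y
        have d1 := (ha ε).differentiable (by simp) y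
        have d2 := (hb ε).differentiable (by simp) y
        have d3 := (hu ε).differentiable (by simp)
        rw [fderiv_fun_sub ((d3 _).fun_comp' y d1) ((d3 _).fun_comp' y d2), fderiv_fun_sub d1 d2,
          fderiv_fun_comp y (d3 _) d1, fderiv_fun_comp y (d3 _) d2]
        simp
      have n1 := negBound_bilin (g := g) (S := S) (ContinuousLinearMap.compL ℝ D D' V)
        (u := fun ε y => fderiv ℝ (u ε) (a ε y) - fderiv ℝ (u ε) (b ε y))
        (v := fun ε => fderiv ℝ (a ε))
        (fun ε => ((hdu ε).comp (ha ε)).sub ((hdu ε).comp (hb ε))) hda k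
        (fun j hj => ih j (by omega) hdu hdu')
        (fun j _ => by simpa only [norm_iteratedFDeriv_fderiv] using ha' (j + 1))
      have n2 := negBound_bilin (g := g) (S := S) (ContinuousLinearMap.compL ℝ D D' V).flip
        (u := fun ε => fderiv ℝ (fun y => a ε y - b ε y))
        (v := fun ε y => fderiv ℝ (u ε) (b ε y))
        (fun ε => ((ha ε).sub (hb ε)).fderiv_right (by simp))
        (fun ε => (hdu ε).comp (hb ε)) k
        (fun j _ => by simpa only [norm_iteratedFDeriv_fderiv] using hab (j + 1))
        (fun j _ => modBound_comp hdu hb hbT j hdu' hb')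
      refine (n1.add n2).mono (Eventually.of_forall fun ε x _ => ?_)
      rw [← norm_iteratedFDeriv_fderiv, e]
      have c1 : ContDiff ℝ ∞ fun y => ContinuousLinearMap.compL ℝ D D' V
          (fderiv ℝ (u ε) (a ε y) - fderiv ℝ (u ε) (b ε y)) (fderiv ℝ (a ε) y) :=
        (ContinuousLinearMap.compL ℝ D D' V).isBoundedBilinearMap.contDiff.comp
          ((((hdu ε).comp (ha ε)).sub ((hdu ε).comp (hb ε))).prodMk (hda ε))
      have c2 : ContDiff ℝ ∞ fun y => ContinuousLinearMap.compL ℝ D D' V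
          (fderiv ℝ (u ε) (b ε y)) (fderiv ℝ (fun y => a ε y - b ε y) y) :=
        (ContinuousLinearMap.compL ℝ D D' V).isBoundedBilinearMap.contDiff.comp
          (((hdu ε).comp (hb ε)).prodMk (((ha ε).sub (hb ε)).fderiv_right (by simp)))
      refine (le_of_eq (congrArg norm (iteratedFDeriv_add_apply
        (c1.of_le (mod_cast le_top)).contDiffAt
        (c2.of_le (mod_cast le_top)).contDiffAt))).trans (norm_add_le _ _)

end Stability

section Core

variable {D : Type} [NormedAddCommGroup D] [NormedSpace ℝ D] {g : Growth D} {S : Set D}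
variable {D' : Type} [NormedAddCommGroup D'] [NormedSpace ℝ D'] {g' : Growth D'}
variable {V : Type} [NormedAddCommGroup V] [NormedSpace ℝ V]
variable {W : Type} [NormedAddCommGroup W] [NormedSpace ℝ W]
variable {V₁ : Type} [NormedAddCommGroup V₁] [NormedSpace ℝ V₁]
variable {V₂ : Type} [NormedAddCommGroup V₂] [NormedSpace ℝ V₂]

/-- Smoothness together with the moderate bounds for small `ε` (auxiliary). -/
def IsCore (g : Growth D) (u : Idx → D → V) : Prop :=
  (∀ ε, ContDiff ℝ ∞ (u ε)) ∧
    ∀ S ∈ g.sets, ∀ k : ℕ, ModBound g S fun ε x => ‖iteratedFDeriv ℝ k (u ε) x‖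

theorem isModerate_iff {u : Idx → D → V} :
    IsModerate g u ↔ IsCore g u ∧ ∀ ε₀, IsCore g fun _ : Idx => u ε₀ := by
  constructor
  · intro h
    exact ⟨⟨h.contDiff, h.2⟩, fun ε₀ => ⟨fun _ => h.contDiff ε₀,
      (slowlyIncreasing_iff.1 (h.1 ε₀)).2⟩⟩
  · intro h
    exact ⟨fun ε₀ => slowlyIncreasing_iff.2 ⟨h.1.1 ε₀, (h.2 ε₀).2⟩, h.1.2⟩

theorem isNegligible_iff {u : Idx → D → V} : IsNegligible g u ↔ IsModerate g u ∧
    ∀ S ∈ g.sets, ∀ k : ℕ, NegBound g S fun ε x => ‖iteratedFDeriv ℝ k (u ε) x‖ := by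
  constructor
  · intro h
    refine ⟨⟨h.1, fun S hS k => ?_⟩, h.2⟩
    obtain ⟨p, hp⟩ := h.2 S hS k
    obtain ⟨C, hC⟩ := hp 0
    refine ⟨p, |C|, ?_⟩
    filter_upwards [hC] with ε hε x hx
    refine (hε x hx).trans ?_
    have h1 : (1 : ℝ) ≤ (ε : ℝ)⁻¹ ^ p := one_le_pow₀ (one_le_inv ε)
    have h2 : C * (ε : ℝ) ^ 0 ≤ |C| * (ε : ℝ)⁻¹ ^ p := by
      rw [pow_zero]
      nlinarith [le_abs_self C, abs_nonneg C]
    exact mul_le_mul_of_nonneg_right h2 (pow_nonneg (zero_le_one.trans (g.one_le x)) p)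
  · exact fun h => ⟨h.1.1, h.2⟩

theorem IsCore.add {u v : Idx → D → V} (hu : IsCore g u) (hv : IsCore g v) :
    IsCore g fun ε x => u ε x + v ε x := by
  refine ⟨fun ε => (hu.1 ε).add (hv.1 ε), fun S hS k => ?_⟩
  refine ((hu.2 S hS k).add (hv.2 S hS k)).mono (Eventually.of_forall fun ε x _ => ?_)
  exact (le_of_eq (congrArg norm (iteratedFDeriv_add_apply
    ((hu.1 ε).of_le (mod_cast le_top)).contDiffAt
    ((hv.1 ε).of_le (mod_cast le_top)).contDiffAt))).trans (norm_add_le _ _)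

theorem negBound_add {u v : Idx → D → V} (hu : ∀ ε, ContDiff ℝ ∞ (u ε))
    (hv : ∀ ε, ContDiff ℝ ∞ (v ε)) (k : ℕ)
    (hu' : NegBound g S fun ε x => ‖iteratedFDeriv ℝ k (u ε) x‖)
    (hv' : NegBound g S fun ε x => ‖iteratedFDeriv ℝ k (v ε) x‖) :
    NegBound g S fun ε x => ‖iteratedFDeriv ℝ k (fun y => u ε y + v ε y) x‖ := by
  refine (hu'.add hv').mono (Eventually.of_forall fun ε x _ => ?_)
  exact (le_of_eq (congrArg norm (iteratedFDeriv_add_apply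
    ((hu ε).of_le (mod_cast le_top)).contDiffAt
    ((hv ε).of_le (mod_cast le_top)).contDiffAt))).trans (norm_add_le _ _)

theorem IsCore.clm (A : V →L[ℝ] W) {u : Idx → D → V} (hu : IsCore g u) :
    IsCore g fun ε x => A (u ε x) := by
  refine ⟨fun ε => A.contDiff.comp (hu.1 ε), fun S hS k => ?_⟩
  refine ((ModBound.const ‖A‖).mul (hu.2 S hS k) (fun _ _ => norm_nonneg _)
    fun _ _ => norm_nonneg _).mono (Eventually.of_forall fun ε x _ => ?_)
  exact A.norm_iteratedFDeriv_comp_left (n := k)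
    ((hu.1 ε).of_le (mod_cast le_top)).contDiffAt le_rfl

theorem negBound_clm (A : V →L[ℝ] W) {u : Idx → D → V} (hu : ∀ ε, ContDiff ℝ ∞ (u ε)) (k : ℕ)
    (hu' : NegBound g S fun ε x => ‖iteratedFDeriv ℝ k (u ε) x‖) :
    NegBound g S fun ε x => ‖iteratedFDeriv ℝ k (fun y => A (u ε y)) x‖ := by
  refine (hu'.mul (ModBound.const ‖A‖) (fun _ _ => norm_nonneg _)
    fun _ _ => norm_nonneg _).mono (Eventually.of_forall fun ε x _ => ?_)
  rw [mul_comm]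
  exact A.norm_iteratedFDeriv_comp_left (n := k)
    ((hu ε).of_le (mod_cast le_top)).contDiffAt le_rfl

theorem IsCore.fderiv {u : Idx → D → V} (hu : IsCore g u) :
    IsCore g fun ε x => fderiv ℝ (u ε) x := by
  refine ⟨fun ε => (hu.1 ε).fderiv_right (by simp), fun S hS k => ?_⟩
  refine (hu.2 S hS (k + 1)).mono (Eventually.of_forall fun ε x _ => le_of_eq ?_)
  exact norm_iteratedFDeriv_fderiv

theorem IsCore.bilin (B : V₁ →L[ℝ] V₂ →L[ℝ] V) {u : Idx → D → V₁} {v : Idx → D → V₂}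
    (hu : IsCore g u) (hv : IsCore g v) : IsCore g fun ε x => B (u ε x) (v ε x) :=
  ⟨fun ε => B.isBoundedBilinearMap.contDiff.comp ((hu.1 ε).prodMk (hv.1 ε)), fun S hS k =>
    modBound_bilin B hu.1 hv.1 k (fun j _ => hu.2 S hS j) fun j _ => hv.2 S hS j⟩

theorem IsCore.comp {u : Idx → D' → V} {a : Idx → D → D'} (hu : IsCore g' u) (ha : IsCore g a)
    (haT : ∀ S ∈ g.sets, ∃ T ∈ g'.sets, ∀ ε, ∀ x ∈ S, a ε x ∈ T) :
    IsCore g fun ε x => u ε (a ε x) := by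
  refine ⟨fun ε => (hu.1 ε).comp (ha.1 ε), fun S hS k => ?_⟩
  obtain ⟨T, hT, h⟩ := haT S hS
  exact modBound_comp hu.1 ha.1 h k (hu.2 T hT) (ha.2 S hS)

theorem IsCore.ofBounded (A : D →L[ℝ] V)
    (hA : ∀ S ∈ g.sets, ∃ C : ℝ, ∀ x ∈ S, ‖A x‖ ≤ C * (1 + g.weight x)) :
    IsCore g fun _ x => A x := by
  refine ⟨fun ε => A.contDiff, fun S hS k => ?_⟩
  cases k with
  | zero =>
    obtain ⟨C, hC⟩ := hA S hS
    refine (((ModBound.const |C|).mul ((ModBound.const 1).add ModBound.weight)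
      (fun _ _ => abs_nonneg C) fun _ x => zero_le_one.trans (g.one_le x))).mono
      (Eventually.of_forall fun ε x hx => ?_)
    rw [norm_iteratedFDeriv_zero]
    exact (hC x hx).trans (mul_le_mul_of_nonneg_right (le_abs_self C)
      (zero_le_one.trans (g.one_le x)))
  | succ k =>
    refine (ModBound.const ‖A‖).mono (Eventually.of_forall fun ε x _ => ?_)
    rw [← norm_iteratedFDeriv_fderiv]
    have e : _root_.fderiv ℝ (fun x => A x) = fun _ => A := by
      funext y; exact A.fderiv
    rw [e]
    cases k with
    | zero => rw [norm_iteratedFDeriv_zero]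
    | succ k =>
      rw [iteratedFDeriv_const_of_ne (Nat.succ_ne_zero k)]
      simp

theorem IsModerate.map₁ {u : Idx → D → V} (hu : IsModerate g u) {F : (Idx → D → V) → Idx → D' → W}
    (hF : ∀ u, IsCore g u → IsCore g' (F u))
    (hc : ∀ u ε₀, (fun _ : Idx => F u ε₀) = F fun _ => u ε₀) : IsModerate g' (F u) := by
  rw [isModerate_iff] at hu ⊢
  exact ⟨hF u hu.1, fun ε₀ => by rw [hc]; exact hF _ (hu.2 ε₀)⟩

theorem IsModerate.add {u v : Idx → D → V} (hu : IsModerate g u) (hv : IsModerate g v) :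
    IsModerate g fun ε x => u ε x + v ε x := by
  rw [isModerate_iff] at hu hv ⊢
  exact ⟨hu.1.add hv.1, fun ε₀ => (hu.2 ε₀).add (hv.2 ε₀)⟩

theorem IsModerate.clm (A : V →L[ℝ] W) {u : Idx → D → V} (hu : IsModerate g u) :
    IsModerate g fun ε x => A (u ε x) :=
  hu.map₁ (F := fun u ε x => A (u ε x)) (fun _ h => h.clm A) fun _ _ => rfl

theorem IsModerate.neg {u : Idx → D → V} (hu : IsModerate g u) :
    IsModerate g fun ε x => -u ε x :=
  hu.clm (-ContinuousLinearMap.id ℝ V)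

theorem IsModerate.fderiv {u : Idx → D → V} (hu : IsModerate g u) :
    IsModerate g fun ε x => fderiv ℝ (u ε) x :=
  hu.map₁ (F := fun u ε x => _root_.fderiv ℝ (u ε) x) (fun _ h => h.fderiv) fun _ _ => rfl

theorem IsModerate.bilin (B : V₁ →L[ℝ] V₂ →L[ℝ] V) {u : Idx → D → V₁} {v : Idx → D → V₂}
    (hu : IsModerate g u) (hv : IsModerate g v) : IsModerate g fun ε x => B (u ε x) (v ε x) := by
  rw [isModerate_iff] at hu hv ⊢
  exact ⟨hu.1.bilin B hv.1, fun ε₀ => (hu.2 ε₀).bilin B (hv.2 ε₀)⟩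

theorem IsModerate.comp {u : Idx → D' → V} {a : Idx → D → D'} (hu : IsModerate g' u)
    (ha : IsModerate g a) (haT : ∀ S ∈ g.sets, ∃ T ∈ g'.sets, ∀ ε, ∀ x ∈ S, a ε x ∈ T) :
    IsModerate g fun ε x => u ε (a ε x) := by
  rw [isModerate_iff] at hu ha ⊢
  refine ⟨hu.1.comp ha.1 haT, fun ε₀ => (hu.2 ε₀).comp (ha.2 ε₀) fun S hS => ?_⟩
  obtain ⟨T, hT, h⟩ := haT S hS
  exact ⟨T, hT, fun _ => h ε₀⟩

theorem IsModerate.ofBounded (A : D →L[ℝ] V)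
    (hA : ∀ S ∈ g.sets, ∃ C : ℝ, ∀ x ∈ S, ‖A x‖ ≤ C * (1 + g.weight x)) :
    IsModerate g fun _ x => A x :=
  isModerate_iff.2 ⟨IsCore.ofBounded A hA, fun _ => IsCore.ofBounded A hA⟩

theorem IsNegligible.add {u v : Idx → D → V} (hu : IsNegligible g u) (hv : IsNegligible g v) :
    IsNegligible g fun ε x => u ε x + v ε x := by
  rw [isNegligible_iff] at hu hv ⊢
  exact ⟨hu.1.add hv.1, fun S hS k =>
    negBound_add hu.1.contDiff hv.1.contDiff k (hu.2 S hS k) (hv.2 S hS k)⟩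

theorem IsNegligible.clm (A : V →L[ℝ] W) {u : Idx → D → V} (hu : IsNegligible g u) :
    IsNegligible g fun ε x => A (u ε x) := by
  rw [isNegligible_iff] at hu ⊢
  exact ⟨hu.1.clm A, fun S hS k => negBound_clm A hu.1.contDiff k (hu.2 S hS k)⟩

theorem IsNegligible.fderiv {u : Idx → D → V} (hu : IsNegligible g u) :
    IsNegligible g fun ε x => fderiv ℝ (u ε) x := by
  rw [isNegligible_iff] at hu ⊢
  refine ⟨hu.1.fderiv, fun S hS k => ?_⟩
  exact (hu.2 S hS (k + 1)).mono (Eventually.of_forall fun ε x _ =>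
    le_of_eq norm_iteratedFDeriv_fderiv)

theorem IsNegligible.bilin (B : V₁ →L[ℝ] V₂ →L[ℝ] V) {u : Idx → D → V₁} {v : Idx → D → V₂}
    (hu : IsNegligible g u) (hv : IsModerate g v) :
    IsNegligible g fun ε x => B (u ε x) (v ε x) := by
  rw [isNegligible_iff] at hu ⊢
  exact ⟨hu.1.bilin B hv, fun S hS k => negBound_bilin B hu.1.contDiff hv.contDiff k
    (fun j _ => hu.2 S hS j) fun j _ => hv.2 S hS j⟩

theorem IsNegligible.comp_sub_comp {u u' : Idx → D' → V} {a a' : Idx → D → D'}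
    (hu : IsModerate g' u) (hu' : IsModerate g' u') (ha : IsModerate g a) (ha' : IsModerate g a')
    (huu : IsNegligible g' fun ε x => u ε x - u' ε x)
    (haa : IsNegligible g fun ε x => a ε x - a' ε x)
    (haT : ∀ S ∈ g.sets, ∃ T ∈ g'.sets, Convex ℝ T ∧ ∀ ε, ∀ x ∈ S, a ε x ∈ T ∧ a' ε x ∈ T) :
    IsNegligible g fun ε x => u ε (a ε x) - u' ε (a' ε x) := by
  have h1 : IsModerate g fun ε x => u ε (a ε x) := hu.comp ha fun S hS => by
    obtain ⟨T, hT, _, h⟩ := haT S hS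
    exact ⟨T, hT, fun ε x hx => (h ε x hx).1⟩
  have h2 : IsModerate g fun ε x => u' ε (a' ε x) := hu'.comp ha' fun S hS => by
    obtain ⟨T, hT, _, h⟩ := haT S hS
    exact ⟨T, hT, fun ε x hx => (h ε x hx).2⟩
  refine isNegligible_iff.2 ⟨by simpa only [sub_eq_add_neg] using h1.add h2.neg,
    fun S hS k => ?_⟩
  obtain ⟨T, hT, hconv, h⟩ := haT S hS
  have n1 := negBound_comp (fun ε => (huu.1 ε).1) ha.contDiff (fun ε x hx => (h ε x hx).1) k
    (huu.2 T hT) (ha.2 S hS)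
  have n2 := negBound_comp_sub hconv ha.contDiff ha'.contDiff (fun ε x hx => (h ε x hx).1)
    (fun ε x hx => (h ε x hx).2) (ha.2 S hS) (ha'.2 S hS) (haa.2 S hS) k hu'.contDiff (hu'.2 T hT)
  have n3 := negBound_add (fun ε => ((huu.1 ε).1).comp (ha.contDiff ε))
    (fun ε => ((hu'.contDiff ε).comp (ha.contDiff ε)).sub ((hu'.contDiff ε).comp (ha'.contDiff ε)))
    k n1 n2
  simpa only [Function.comp_apply, sub_add_sub_cancel] using n3

end Core

/-! ### The algebras, generalized points and generalized numbers -/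

section Quotients

variable {D : Type} [NormedAddCommGroup D] [NormedSpace ℝ D]
variable {V : Type} [NormedAddCommGroup V] [NormedSpace ℝ V]

/-- The moderate nets of growth type `g` with values in `V`. -/
def moderate (g : Growth D) (V : Type) [NormedAddCommGroup V] [NormedSpace ℝ V] :
    AddSubgroup (Idx → D → V) where
  carrier := {u | IsModerate g u}
  zero_mem' := IsModerate.ofBounded 0 fun _ _ => ⟨0, fun x _ => by simp⟩
  add_mem' := fun hu hv => hu.add hv
  neg_mem' := fun hu => hu.neg

/-- The negligible nets of growth type `g` with values in `V`. -/
def negligible (g : Growth D) (V : Type) [NormedAddCommGroup V] [NormedSpace ℝ V] :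
    AddSubgroup (Idx → D → V) where
  carrier := {u | IsNegligible g u}
  zero_mem' := isNegligible_iff.2 ⟨(moderate g V).zero_mem, fun S _ k => by
    refine NegBound.zero.mono (Eventually.of_forall fun ε x _ => le_of_eq ?_)
    have : iteratedFDeriv ℝ k ((0 : Idx → D → V) ε) = 0 := iteratedFDeriv_fun_zero
    rw [this]
    simp⟩
  add_mem' := fun hu hv => hu.add hv
  neg_mem' := fun hu => hu.clm (-ContinuousLinearMap.id ℝ V)

/-- The quotient of the elements of `M` by those of `N`. -/
abbrev SubQuot {A : Type} [AddCommGroup A] (M N : AddSubgroup A) : Type :=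
  M ⧸ N.addSubgroupOf M

/-- `V`-valued generalized functions on `D` of growth type `g`: moderate nets modulo negligible
ones. For `V = ℝⁿ` these are the `n`-tuples of scalar generalized functions. As all norms on a
finite-dimensional space are equivalent, it does not matter for the nets which norm is taken, nor
that all partial derivatives of order `k` are bounded at once through the `k`-th Fréchet
derivative. -/
abbrev GenFun (g : Growth D) (V : Type) [NormedAddCommGroup V] [NormedSpace ℝ V] : Type :=
  SubQuot (moderate g V) (negligible g V)

/-- The Colombeau algebra `𝒢(E)`, with values in `V`. -/
abbrev GG (E V : Type) [NormedAddCommGroup E] [NormedSpace ℝ E] [NormedAddCommGroup V]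
    [NormedSpace ℝ V] : Type := GenFun (growthG E) V

/-- The algebra `𝒢_τ(H)` of tempered generalized functions, with values in `V`. -/
abbrev GTau (H V : Type) [NormedAddCommGroup H] [NormedSpace ℝ H] [NormedAddCommGroup V]
    [NormedSpace ℝ V] : Type := GenFun (growthTau H) V

/-- The algebra `𝒢̃_τ(E × H)`, with `𝒢`-bounds in `E` and `𝒢_τ`-bounds in `H`, with values
in `V`. -/
abbrev GMix (E H V : Type) [NormedAddCommGroup E] [NormedSpace ℝ E] [NormedAddCommGroup H]
    [NormedSpace ℝ H] [NormedAddCommGroup V] [NormedSpace ℝ V] : Type :=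
  GenFun (growthMixed E H) V

/-- The nets of points of `V` that are `O(ε^{-p})` for some `p`. -/
def moderatePts (V : Type) [NormedAddCommGroup V] : AddSubgroup (Idx → V) where
  carrier := {x | ∃ (p : ℕ) (C : ℝ), ∀ᶠ ε in epsToZero, ‖x ε‖ ≤ C * ((ε : ℝ)⁻¹) ^ p}
  zero_mem' := ⟨0, 0, Eventually.of_forall fun ε => by simp⟩
  add_mem' := by
    rintro x y ⟨p, C, h⟩ ⟨p', C', h'⟩
    refine ⟨p + p', |C| + |C'|, ?_⟩
    filter_upwards [h, h'] with ε h1 h2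
    have e1 : ∀ n, (1 : ℝ) ≤ (ε : ℝ)⁻¹ ^ n := fun n => one_le_pow₀ (one_le_inv ε)
    have k1 : C * (ε : ℝ)⁻¹ ^ p ≤ |C| * (ε : ℝ)⁻¹ ^ (p + p') := by
      have := one_le_inv ε
      have := e1 p
      gcongr
      · exact le_abs_self C
      · omega
    have k2 : C' * (ε : ℝ)⁻¹ ^ p' ≤ |C'| * (ε : ℝ)⁻¹ ^ (p + p') := by
      have := one_le_inv ε
      have := e1 p'
      gcongr
      · exact le_abs_self C'
      · omega
    calc ‖x ε + y ε‖ ≤ ‖x ε‖ + ‖y ε‖ := norm_add_le _ _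
      _ ≤ _ := add_le_add (h1.trans k1) (h2.trans k2)
      _ = _ := by ring
  neg_mem' := by
    rintro x ⟨p, C, h⟩
    exact ⟨p, C, by simpa using h⟩

/-- The nets of points of `V` that are `O(ε^q)` for all `q`. -/
def negligiblePts (V : Type) [NormedAddCommGroup V] : AddSubgroup (Idx → V) where
  carrier := {x | ∀ q : ℕ, ∃ C : ℝ, ∀ᶠ ε in epsToZero, ‖x ε‖ ≤ C * (ε : ℝ) ^ q}
  zero_mem' := fun q => ⟨0, Eventually.of_forall fun ε => by simp⟩
  add_mem' := by
    intro x y hx hy q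
    obtain ⟨C, h⟩ := hx q
    obtain ⟨C', h'⟩ := hy q
    refine ⟨C + C', ?_⟩
    filter_upwards [h, h'] with ε h1 h2
    calc ‖x ε + y ε‖ ≤ ‖x ε‖ + ‖y ε‖ := norm_add_le _ _
      _ ≤ _ := add_le_add h1 h2
      _ = _ := by ring
  neg_mem' := by
    intro x hx q
    obtain ⟨C, h⟩ := hx q
    exact ⟨C, by simpa using h⟩

/-- The generalized points of `V`: moderate nets of points modulo negligible ones. For `V = ℝ`
this is the ring `𝓡` of generalized numbers, and for `V = ℝⁿ` it is `𝓡ⁿ`. -/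
abbrev GenPt (V : Type) [NormedAddCommGroup V] : Type := SubQuot (moderatePts V) (negligiblePts V)

end Quotients

section Lifting

variable {A B C : Type} [AddCommGroup A] [AddCommGroup B] [AddCommGroup C]
variable {M N : AddSubgroup A} {M' N' : AddSubgroup B} {M'' N'' : AddSubgroup C}

/-- The class of an element. -/
def SubQuot.mk (M N : AddSubgroup A) (a : A) (ha : a ∈ M) : SubQuot M N :=
  QuotientAddGroup.mk ⟨a, ha⟩

/-- A map of representatives, as a map of classes. -/
def SubQuot.map (T : A → B) (hM : ∀ a ∈ M, T a ∈ M')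
    (hN : ∀ a ∈ M, ∀ b ∈ M, a - b ∈ N → T a - T b ∈ N') : SubQuot M N → SubQuot M' N' :=
  Quotient.map' (fun a => ⟨T a, hM a a.2⟩) fun a b h => by
    rw [QuotientAddGroup.leftRel_apply, AddSubgroup.mem_addSubgroupOf] at h ⊢
    have := hN b b.2 a a.2 (by simpa [neg_add_eq_sub] using h)
    simpa [neg_add_eq_sub] using this

/-- A map of pairs of representatives, as a map of pairs of classes. -/
def SubQuot.map₂ (T : A → B → C) (hM : ∀ a ∈ M, ∀ b ∈ M', T a b ∈ M'')
    (hN : ∀ a ∈ M, ∀ a' ∈ M, ∀ b ∈ M', ∀ b' ∈ M', a - a' ∈ N → b - b' ∈ N' →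
      T a b - T a' b' ∈ N'') : SubQuot M N → SubQuot M' N' → SubQuot M'' N'' :=
  Quotient.map₂ (fun a b => ⟨T a b, hM a a.2 b b.2⟩) fun a a' h b b' h' => by
    change QuotientAddGroup.leftRel _ _ _ at h h'
    change QuotientAddGroup.leftRel _ _ _
    rw [QuotientAddGroup.leftRel_apply, AddSubgroup.mem_addSubgroupOf] at h h' ⊢
    have := hN a' a'.2 a a.2 b' b'.2 b b.2 (by simpa [neg_add_eq_sub] using h)
      (by simpa [neg_add_eq_sub] using h')
    simpa [neg_add_eq_sub] using this

end Lifting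

/-! ### Operations on generalized functions, componentwise in `ε` -/

section Operations

variable {D : Type} [NormedAddCommGroup D] [NormedSpace ℝ D] {g : Growth D}
variable {E : Type} [NormedAddCommGroup E] [NormedSpace ℝ E]
variable {H : Type} [NormedAddCommGroup H] [NormedSpace ℝ H]
variable {V : Type} [NormedAddCommGroup V] [NormedSpace ℝ V]
variable {W : Type} [NormedAddCommGroup W] [NormedSpace ℝ W]

theorem GenFun.sub_mem {u v : Idx → D → V} (h : u - v ∈ negligible g V) :
    IsNegligible g fun ε x => u ε x - v ε x := h

/-- The class of the constant net `ε ↦ A` of a linear map of weighted growth. -/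
noncomputable def GenFun.ofLinear (g : Growth D) (A : D →L[ℝ] V)
    (hA : ∃ C : ℝ, ∀ x, ‖A x‖ ≤ C * (1 + g.weight x)) : GenFun g V :=
  SubQuot.mk _ _ (fun _ x => A x)
    (IsModerate.ofBounded A fun _ _ => ⟨hA.choose, fun x _ => hA.choose_spec x⟩)

/-- The linear map `A` as a tempered generalized function. -/
noncomputable def GTau.ofLinear (A : H →L[ℝ] V) : GTau H V :=
  GenFun.ofLinear (growthTau H) A ⟨‖A‖, fun x => (A.le_opNorm x).trans
    (mul_le_mul_of_nonneg_left (by simp [growthTau]) (norm_nonneg A))⟩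

/-- The projection `(x, y) ↦ y` as an element of `𝒢̃_τ(E × H)`. -/
noncomputable def GMix.snd (E H : Type) [NormedAddCommGroup E] [NormedSpace ℝ E] [NormedAddCommGroup H]
    [NormedSpace ℝ H] : GMix E H H :=
  GenFun.ofLinear (growthMixed E H) (ContinuousLinearMap.snd ℝ E H)
    ⟨1, fun x => by simp [growthMixed]⟩

/-- The application of a linear map to the values: `x ↦ A (u x)`. -/
noncomputable def GenFun.postcomp (A : V →L[ℝ] W) : GenFun g V → GenFun g W :=
  SubQuot.map (fun u ε x => A (u ε x)) (fun _ hu => IsModerate.clm A hu) fun u _ v _ h => by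
    have := IsNegligible.clm A (GenFun.sub_mem h)
    simpa only [map_sub] using! this

/-- The derivative in the direction `e`. -/
noncomputable def GenFun.dirDeriv (e : D) : GenFun g V → GenFun g V :=
  SubQuot.map (fun u ε x => fderiv ℝ (u ε) x e)
    (fun _ hu => (IsModerate.fderiv hu).clm (ContinuousLinearMap.apply ℝ V e))
    fun u hu v hv h => by
      have := (IsNegligible.fderiv (GenFun.sub_mem h)).clm (ContinuousLinearMap.apply ℝ V e)
      have e1 : (fun ε x => ContinuousLinearMap.apply ℝ V e (fderiv ℝ (fun y => u ε y - v ε y) x)) =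
          (fun ε x => fderiv ℝ (u ε) x e) - fun ε x => fderiv ℝ (v ε) x e := by
        funext ε x
        rw [fderiv_fun_sub ((IsModerate.contDiff hu ε).differentiable (by simp) x)
          ((IsModerate.contDiff hv ε).differentiable (by simp) x)]
        rfl
      rw [e1] at this
      exact this

/-- The product of scalar generalized functions. -/
noncomputable def GenFun.mul : GenFun g ℝ → GenFun g ℝ → GenFun g ℝ :=
  SubQuot.map₂ (fun u v ε x => u ε x * v ε x)
    (fun _ hu _ hv => IsModerate.bilin (ContinuousLinearMap.mul ℝ ℝ) hu hv)
    fun u _ u' hu' v hv v' _ h h' => by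
      have h1 := (GenFun.sub_mem h).bilin (ContinuousLinearMap.mul ℝ ℝ) hv
      have h2 := (GenFun.sub_mem h').bilin (ContinuousLinearMap.mul ℝ ℝ) hu'
      have h3 := h1.add h2
      have e1 : (fun ε x => ContinuousLinearMap.mul ℝ ℝ (u ε x - u' ε x) (v ε x) +
          ContinuousLinearMap.mul ℝ ℝ (v ε x - v' ε x) (u' ε x)) =
          (fun ε x => u ε x * v ε x) - fun ε x => u' ε x * v' ε x := by
        funext ε x
        simp only [ContinuousLinearMap.mul_apply', Pi.sub_apply]
        ring
      rw [e1] at h3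
      exact h3

noncomputable instance : Mul (GenFun g ℝ) := ⟨GenFun.mul⟩

/-- The composition `x ↦ f (a x)` of a tempered generalized function with a generalized
function. -/
noncomputable def GTau.comp : GTau H V → GenFun g H → GenFun g V :=
  SubQuot.map₂ (fun f a ε x => f ε (a ε x))
    (fun _ hf _ ha => IsModerate.comp hf ha fun _ _ => ⟨Set.univ, rfl, fun _ _ _ => trivial⟩)
    fun _ hf _ hf' _ ha _ ha' h h' => IsNegligible.comp_sub_comp hf hf' ha ha' h h' fun _ _ =>
      ⟨Set.univ, rfl, convex_univ, fun _ _ _ => ⟨trivial, trivial⟩⟩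

theorem isModerate_pair {L : D →L[ℝ] E}
    (hL : ∀ S ∈ g.sets, ∃ K, IsCompact K ∧ ∀ d ∈ S, L d ∈ K) {a : Idx → D → H}
    (ha : IsModerate g a) : IsModerate g fun ε d => ((L d, a ε d) : E × H) := by
  have h1 : IsModerate g fun (_ : Idx) d => L d := IsModerate.ofBounded L fun S hS => by
    obtain ⟨K, hK, h⟩ := hL S hS
    obtain ⟨R, hR⟩ := hK.isBounded.exists_norm_le
    refine ⟨|R|, fun x hx => ((hR _ (h x hx)).trans (le_abs_self R)).trans ?_⟩
    exact le_mul_of_one_le_right (abs_nonneg R) (g.one_le x)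
  have h2 := (h1.clm (ContinuousLinearMap.inl ℝ E H)).add (ha.clm (ContinuousLinearMap.inr ℝ E H))
  simpa using h2

theorem pair_mem_convex [ProperSpace E] {L : D →L[ℝ] E}
    (hL : ∀ S ∈ g.sets, ∃ K, IsCompact K ∧ ∀ d ∈ S, L d ∈ K) (S : Set D) (hS : S ∈ g.sets) :
    ∃ T ∈ (growthMixed E H).sets, Convex ℝ T ∧ ∀ d ∈ S, ∀ y : H, ((L d, y) : E × H) ∈ T := by
  obtain ⟨K, hK, h⟩ := hL S hS
  obtain ⟨R, hR⟩ := hK.isBounded.exists_norm_le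
  refine ⟨Metric.closedBall 0 R ×ˢ Set.univ, ⟨_, isCompact_closedBall 0 R, rfl⟩,
    (convex_closedBall 0 R).prod convex_univ, fun d hd y => ⟨?_, trivial⟩⟩
  simpa using hR _ (h d hd)

/-- The composition `d ↦ Φ (L d, a d)`, where the linear map `L` is inserted for the first
variable of `Φ` and the generalized function `a` for the second one. -/
noncomputable def GMix.insert [ProperSpace E] (L : D →L[ℝ] E)
    (hL : ∀ S ∈ g.sets, ∃ K, IsCompact K ∧ ∀ d ∈ S, L d ∈ K) :
    GMix E H V → GenFun g H → GenFun g V :=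
  SubQuot.map₂ (fun u a ε d => u ε (L d, a ε d))
    (fun u hu a ha => IsModerate.comp (u := u) (a := fun ε d => (L d, a ε d)) hu
      (isModerate_pair hL ha) fun S hS => by
        obtain ⟨T, hT, _, h⟩ := pair_mem_convex (H := H) hL S hS
        exact ⟨T, hT, fun ε x hx => h x hx _⟩)
    fun u hu u' hu' a ha a' ha' h h' => by
      refine IsNegligible.comp_sub_comp (u := u) (u' := u') (a := fun ε d => (L d, a ε d))
        (a' := fun ε d => (L d, a' ε d)) hu hu' (isModerate_pair hL ha) (isModerate_pair hL ha') h
        ?_ fun S hS => ?_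
      · have := (GenFun.sub_mem h').clm (ContinuousLinearMap.inr ℝ E H)
        simpa using this
      · obtain ⟨T, hT, hc, h⟩ := pair_mem_convex (H := H) hL S hS
        exact ⟨T, hT, hc, fun ε x hx => ⟨h x hx _, h x hx _⟩⟩

theorem isModerate_const {x : Idx → V} (hx : x ∈ moderatePts V) :
    IsModerate g fun ε (_ : D) => x ε := by
  have key : ∀ y : Idx → V, y ∈ moderatePts V → IsCore g fun ε (_ : D) => y ε := by
    rintro y ⟨p, C, h⟩
    refine ⟨fun ε => contDiff_const, fun S hS k => ?_⟩
    cases k with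
    | zero =>
      refine ⟨p, C, ?_⟩
      filter_upwards [h] with ε hε z _
      rw [norm_iteratedFDeriv_zero]
      exact hε.trans (le_mul_of_one_le_right ((norm_nonneg _).trans hε)
        (one_le_pow₀ (g.one_le z)))
    | succ k =>
      refine (ModBound.const 0).mono (Eventually.of_forall fun ε z _ => ?_)
      rw [iteratedFDeriv_const_of_ne (Nat.succ_ne_zero k)]
      simp
  exact isModerate_iff.2 ⟨key x hx, fun ε₀ => key (fun _ => x ε₀)
    ⟨0, ‖x ε₀‖, Eventually.of_forall fun ε => by simp⟩⟩

theorem isNegligible_const {x : Idx → V} (hx : x ∈ moderatePts V) (hx' : x ∈ negligiblePts V) :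
    IsNegligible g fun ε (_ : D) => x ε := by
  refine isNegligible_iff.2 ⟨isModerate_const hx, fun S _ k => ?_⟩
  cases k with
  | zero =>
    refine ⟨0, fun q => ?_⟩
    obtain ⟨C, hC⟩ := hx' q
    refine ⟨C, ?_⟩
    filter_upwards [hC] with ε hε z _
    rw [norm_iteratedFDeriv_zero]
    simpa using hε
  | succ k =>
    refine NegBound.zero.mono (Eventually.of_forall fun ε z _ => ?_)
    rw [iteratedFDeriv_const_of_ne (Nat.succ_ne_zero k)]
    simp

/-- A generalized point as a constant generalized function. -/
noncomputable def GenFun.const (g : Growth D) : GenPt V → GenFun g V :=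
  SubQuot.map (fun x ε _ => x ε) (fun _ hx => isModerate_const hx)
    fun _ hx _ hy h => isNegligible_const ((moderatePts V).sub_mem hx hy) h

theorem mem_moderatePts_of {u : Idx → E → V} (hu : IsModerate (growthG E) u) (t : E) :
    (fun ε => u ε t) ∈ moderatePts V := by
  obtain ⟨p, C, h⟩ := hu.2 {t} isCompact_singleton 0
  refine ⟨p, C, ?_⟩
  filter_upwards [h] with ε hε
  simpa [growthG, norm_iteratedFDeriv_zero] using hε t rfl

theorem mem_negligiblePts_of {u : Idx → E → V} (hu : IsNegligible (growthG E) u) (t : E) :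
    (fun ε => u ε t) ∈ negligiblePts V := by
  obtain ⟨p, h⟩ := hu.2 {t} isCompact_singleton 0
  intro q
  obtain ⟨C, h⟩ := h q
  refine ⟨C, ?_⟩
  filter_upwards [h] with ε hε
  simpa [growthG, norm_iteratedFDeriv_zero] using hε t rfl

/-- The value of an element of `𝒢(E)` at a point of `E`. -/
noncomputable def GG.at (u : GG E V) (t : E) : GenPt V :=
  SubQuot.map (M := moderate (growthG E) V) (N := negligible (growthG E) V) (fun u ε => u ε t)
    (fun _ hu => mem_moderatePts_of hu t) (fun _ _ _ _ h => mem_negligiblePts_of h t) u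

/-- The value of a tempered generalized function at a generalized point. -/
noncomputable def GTau.at : GTau H V → GenPt H → GenPt V :=
  SubQuot.map₂ (fun f x ε => f ε (x ε))
    (fun f hf x hx => mem_moderatePts_of (u := fun ε (_ : ℝ) => f ε (x ε))
      (IsModerate.comp (g' := growthTau H) (u := f) hf (isModerate_const (D := ℝ) hx)
        fun _ _ => ⟨Set.univ, rfl, fun _ _ _ => trivial⟩) 0)
    fun f hf f' hf' x hx x' hx' h h' => mem_negligiblePts_of
      (u := fun ε (_ : ℝ) => f ε (x ε) - f' ε (x' ε))
      (IsNegligible.comp_sub_comp (g' := growthTau H) (u := f) (u' := f') hf hf'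
        (isModerate_const (D := ℝ) hx) (isModerate_const (D := ℝ) hx') h
        (isNegligible_const (x := x - x') ((moderatePts H).sub_mem hx hx') h') fun _ _ =>
          ⟨Set.univ, rfl, convex_univ, fun _ _ _ => ⟨trivial, trivial⟩⟩) 0

end Operations

/-! ### Generalized vector fields and group actions -/

section Dynamics

variable {H : Type} [NormedAddCommGroup H] [NormedSpace ℝ H]
variable {V : Type} [NormedAddCommGroup V] [NormedSpace ℝ V]

/-- `x ∈ 𝒢(ℝ)` with values in `H` solves `ẋ(t) = ξ(x(t))`, `x(t₀) = x₀`. -/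
def SolvesIVP (ξ : GTau H H) (t₀ : ℝ) (x₀ : GenPt H) (x : GG ℝ H) : Prop :=
  GenFun.dirDeriv (1 : ℝ) x = GTau.comp ξ x ∧ GG.at x t₀ = x₀

/-- The vector field `ξ` is `𝒢`-complete. -/
def IsGComplete (ξ : GTau H H) : Prop :=
  ∀ (x₀ : GenPt H) (t₀ : ℝ), ∃! x : GG ℝ H, SolvesIVP ξ t₀ x₀ x

/-- The restriction `x ↦ Φ(0, x)`. -/
noncomputable def GMix.atZero (Φ : GMix ℝ H V) : GTau H V :=
  GMix.insert 0 (fun _ _ => ⟨{0}, isCompact_singleton, fun _ _ => rfl⟩) Φ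
    (GTau.ofLinear (ContinuousLinearMap.id ℝ H))

/-- The curve `η ↦ Φ(η, x)` through a generalized point `x`, as an element of `𝒢(ℝ)`. -/
noncomputable def GMix.orbit (Φ : GMix ℝ H V) (x : GenPt H) : GG ℝ V :=
  GMix.insert (ContinuousLinearMap.id ℝ ℝ) (fun K hK => ⟨K, hK, fun _ h => h⟩) Φ
    (GenFun.const (growthG ℝ) x)

/-- The composition `((η₁, η₂), x) ↦ Φ(L (η₁, η₂), a((η₁, η₂), x))`. -/
noncomputable def GMix.insertTimes (L : ℝ × ℝ →L[ℝ] ℝ) (Φ : GMix ℝ H V) (a : GMix (ℝ × ℝ) H H) :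
    GMix (ℝ × ℝ) H V :=
  GMix.insert (L.comp (ContinuousLinearMap.fst ℝ (ℝ × ℝ) H))
    (fun S hS => by
      obtain ⟨K, hK, rfl⟩ := hS
      exact ⟨L '' K, hK.image L.continuous, fun d hd => ⟨d.1, hd.1, rfl⟩⟩) Φ a

/-- `Φ` is a generalized group action: `Φ(0, x) = x` in `𝒢_τ`, and
`Φ(η₁ + η₂, x) = Φ(η₁, Φ(η₂, x))` in `𝒢̃_τ(ℝ² × H)`. -/
structure IsGroupAction (Φ : GMix ℝ H H) : Prop where
  zero : GMix.atZero Φ = GTau.ofLinear (ContinuousLinearMap.id ℝ H)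
  add : GMix.insertTimes (ContinuousLinearMap.fst ℝ ℝ ℝ + ContinuousLinearMap.snd ℝ ℝ ℝ) Φ
      (GMix.snd (ℝ × ℝ) H) =
    GMix.insertTimes (ContinuousLinearMap.fst ℝ ℝ ℝ) Φ
      (GMix.insertTimes (ContinuousLinearMap.snd ℝ ℝ ℝ) Φ (GMix.snd (ℝ × ℝ) H))

/-- The vector field `d/dη|₀ Φ(η, ·)`. -/
noncomputable def generator (Φ : GMix ℝ H H) : GTau H H :=
  GMix.atZero (GenFun.dirDeriv ((1 : ℝ), (0 : H)) Φ)

/-- `h` is a flow of `ξ`: for every generalized point `x₀` the curve `η ↦ h(η, x₀)` solves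
`ẋ = ξ(x)`, `x(0) = x₀`. -/
def IsFlow (ξ : GTau H H) (h : GMix ℝ H H) : Prop :=
  ∀ x₀ : GenPt H, SolvesIVP ξ 0 x₀ (GMix.orbit h x₀)

/-- `Φ` is a symmetry group of the equation `F(x) = 0`: if `F(x) = 0` for a generalized point
`x`, then `η ↦ F(Φ(η, x))` is zero in `𝒢(ℝ)`. -/
def IsSymmetryGroup (Φ : GMix ℝ H H) (F : GTau H ℝ) : Prop :=
  ∀ x : GenPt H, GTau.at F x = 0 → GTau.comp F (GMix.orbit Φ x) = 0

end Dynamics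

section Coordinates

/-- The coordinate `x ↦ x_j`. -/
abbrev coord {n : ℕ} (j : Fin n) : (Fin n → ℝ) →L[ℝ] ℝ := ContinuousLinearMap.proj j

/-- The map `x ↦ x' = (x_1, …, x_{i-1}, x_{i+1}, …)` that omits the `i`-th coordinate. -/
noncomputable def omitCoord {n : ℕ} (i : Fin (n + 1)) : (Fin (n + 1) → ℝ) →L[ℝ] (Fin n → ℝ) :=
  ContinuousLinearMap.pi fun j => coord (i.succAbove j)

/-- The function `X(F) = ∑_j ξ_j ∂_j F` for the vector field `X = ∑_j ξ_j ∂_j`. -/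
noncomputable def applyField {n : ℕ} (ξ : GTau (Fin n → ℝ) (Fin n → ℝ)) (F : GTau (Fin n → ℝ) ℝ) :
    GTau (Fin n → ℝ) ℝ :=
  ∑ j : Fin n, GenFun.postcomp (coord j) ξ * GenFun.dirDeriv (Pi.single j (1 : ℝ)) F

/-- The function `x ↦ x_i - f(x')`. -/
noncomputable def graphEquation {n : ℕ} (i : Fin (n + 1)) (f : GTau (Fin n → ℝ) ℝ) :
    GTau (Fin (n + 1) → ℝ) ℝ :=
  GTau.ofLinear (coord i) - GTau.comp f (GTau.ofLinear (omitCoord i))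

/-- The linear map `x' ↦ x` with `x_i = 0` and the other coordinates given by `x'`. -/
noncomputable def insertZero {n : ℕ} (i : Fin (n + 1)) : (Fin n → ℝ) →L[ℝ] (Fin (n + 1) → ℝ) :=
  ContinuousLinearMap.pi (i.insertNth 0 fun j => coord j)

theorem insertNth_eq {n : ℕ} (i : Fin (n + 1)) (r : ℝ) (x : Fin n → ℝ) :
    (i.insertNth r x : Fin (n + 1) → ℝ) =
      ContinuousLinearMap.single ℝ (fun _ : Fin (n + 1) => ℝ) i r + insertZero i x := by
  funext j
  refine Fin.succAboveCases i ?_ (fun j => ?_) j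
  · simp [insertZero]
  · simp [insertZero, Fin.succAbove_ne]

/-- The map `x' ↦ (x', f(x'))`, where `f(x')` is the `i`-th coordinate. -/
noncomputable def graphMap {n : ℕ} (i : Fin (n + 1)) :
    GTau (Fin n → ℝ) ℝ → GTau (Fin n → ℝ) (Fin (n + 1) → ℝ) :=
  SubQuot.map (fun f ε x => i.insertNth (f ε x) x)
    (fun f hf => by
      have h1 := IsModerate.clm (ContinuousLinearMap.single ℝ (fun _ : Fin (n + 1) => ℝ) i) hf
      have h2 : IsModerate (growthTau (Fin n → ℝ)) fun (_ : Idx) x => insertZero i x :=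
        IsModerate.ofBounded _ fun _ _ => ⟨‖insertZero i‖, fun x _ =>
          ((insertZero i).le_opNorm x).trans
            (mul_le_mul_of_nonneg_left (by simp [growthTau]) (norm_nonneg _))⟩
      simp only [insertNth_eq]
      exact h1.add h2)
    fun f _ f' _ h => by
      have h1 := IsNegligible.clm (ContinuousLinearMap.single ℝ (fun _ : Fin (n + 1) => ℝ) i)
        (GenFun.sub_mem h)
      have e : (fun ε x => ContinuousLinearMap.single ℝ (fun _ : Fin (n + 1) => ℝ) i
          (f ε x - f' ε x)) = (fun ε x => i.insertNth (f ε x) x) -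
            fun ε x => i.insertNth (f' ε x) x := by
        funext ε x
        simp only [insertNth_eq, Pi.sub_apply, map_sub]
        abel
      rw [e] at h1
      exact h1

/-- The vector field on `ℝⁿ` with components `x' ↦ ξ_j(x', f(x'))`, `j ≠ i`. -/
noncomputable def restrictedField {n : ℕ} (i : Fin (n + 1)) (f : GTau (Fin n → ℝ) ℝ)
    (ξ : GTau (Fin (n + 1) → ℝ) (Fin (n + 1) → ℝ)) : GTau (Fin n → ℝ) (Fin n → ℝ) :=
  GenFun.postcomp (omitCoord i) (GTau.comp ξ (graphMap i f))

end Coordinates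

end Colombeau

/-! Write `X(F)` for the derivative of `F` along the generator `X` of `Φ`. Differentiating the group
law in its first time at `0` shows that each orbit `η ↦ Φ(η, x)` is an integral curve of `X`
starting at `x` (`solvesIVP_orbit`). By the chain rule, `F` composed with an integral curve `y` of
`X` has derivative `X(F) ∘ y` (`dirDeriv_comp_eq_comp_applyField`). If `Φ` is a symmetry group and
`F(x) = 0`, then `F` is zero along the orbit of `x`, hence so is `X(F)`, and evaluation at time `0`
gives `X(F)(x) = 0`.

For the converse, start at a generalized zero `x` of `F`, follow the flow of the restricted field
from `x'`, and lift this curve to the graph of `f`. The lift `y` satisfies `F ∘ y = 0` by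
construction and starts at `x`. Its coordinates other than the `i`-th satisfy the equation of `X` by
the choice of the flow. The `i`-th follows from `X(F) ∘ y = 0`, because `∂_i F = 1`
(`dirDeriv_comp_graphMap`). Uniqueness of integral curves then identifies `y` with the orbit of `x`,
so `F` vanishes along the orbit.

The delicate point is that the infinitesimal condition speaks of values at generalized points,
whereas `X(F) ∘ y = 0` is an identity in `𝒢(ℝ)`, with all derivatives. `comp_eq_zero_of_at_eq_zero`
bridges this: on a compact set, the points where the net is largest form a single generalized point,
which yields negligibility of order zero. An interpolation inequality of Landau type then supplies
all the derivatives (`isNegligible_of_negBound`). -/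

namespace Colombeau

/-! ### Classes and their representatives. -/

section SubQuot

variable {A : Type} [AddCommGroup A] {M N : AddSubgroup A}

theorem SubQuot.exists_mk (u : SubQuot M N) : ∃ a ha, SubQuot.mk M N a ha = u := by
  obtain ⟨⟨a, ha⟩, rfl⟩ := QuotientAddGroup.mk_surjective u
  exact ⟨a, ha, rfl⟩

theorem SubQuot.mk_eq_mk {a b : A} {ha : a ∈ M} {hb : b ∈ M} :
    SubQuot.mk M N a ha = SubQuot.mk M N b hb ↔ a - b ∈ N := by
  unfold SubQuot.mk
  rw [eq_comm, QuotientAddGroup.eq, AddSubgroup.mem_addSubgroupOf]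
  simp [neg_add_eq_sub]

theorem SubQuot.mk_eq_zero {a : A} {ha : a ∈ M} : SubQuot.mk M N a ha = 0 ↔ a ∈ N := by
  have h : (0 : SubQuot M N) = SubQuot.mk M N 0 M.zero_mem := rfl
  rw [h, SubQuot.mk_eq_mk, sub_zero]

/-- Most identities below already hold between nets, not merely up to negligible ones; this reduces
them to a pointwise computation, whatever the membership proofs are. -/
theorem SubQuot.mk_congr {a b : A} {ha : a ∈ M} {hb : b ∈ M} (h : a = b) :
    SubQuot.mk M N a ha = SubQuot.mk M N b hb := by
  subst h; rfl

theorem SubQuot.sum_mk {ι : Type} (s : Finset ι) (a : ι → A) (ha : ∀ j, a j ∈ M) :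
    ∑ j ∈ s, SubQuot.mk M N (a j) (ha j) =
      SubQuot.mk M N (∑ j ∈ s, a j) (M.sum_mem fun j _ => ha j) := by
  have h := map_sum (QuotientAddGroup.mk' (N.addSubgroupOf M)) (fun j => (⟨a j, ha j⟩ : M)) s
  refine h.symm.trans (congrArg (QuotientAddGroup.mk' (N.addSubgroupOf M)) (Subtype.ext ?_))
  simp

end SubQuot

/-! ### Negligibility of moderate nets on the line from bounds of order zero -/

section Landau

variable {V : Type} [NormedAddCommGroup V] [NormedSpace ℝ V]

/-- First-order Taylor expansion: `r w'(x)` is the increment of `w` over `[x, x + r]` minus a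
remainder of size at most `M r²`. The step `r` stays free, so that it can be tuned to `ε`. -/
theorem norm_deriv_le_of_norm_le {w : ℝ → V} (hw : ContDiff ℝ ∞ w) {x r a M : ℝ} (hr : 0 < r)
    (ha : ∀ s ∈ Set.Icc x (x + r), ‖w s‖ ≤ a)
    (hM : ∀ s ∈ Set.Icc x (x + r), ‖deriv (deriv w) s‖ ≤ M) :
    ‖deriv w x‖ ≤ 2 * a / r + M * r := by
  have hx : x ∈ Set.Icc x (x + r) := ⟨le_rfl, by linarith⟩
  have hxr : x + r ∈ Set.Icc x (x + r) := ⟨by linarith, le_rfl⟩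
  have hM0 : 0 ≤ M := (norm_nonneg _).trans (hM x hx)
  have hd : Differentiable ℝ w := hw.differentiable (by simp)
  have hd' : Differentiable ℝ (deriv w) := by
    have := (contDiff_infty_iff_deriv.1 hw).2
    exact this.differentiable (by simp)
  have h1 : ∀ s ∈ Set.Icc x (x + r), ‖deriv w s - deriv w x‖ ≤ M * r := fun s hs => by
    refine ((convex_Icc x (x + r)).norm_image_sub_le_of_norm_deriv_le
      (fun y _ => hd' y) hM hx hs).trans (mul_le_mul_of_nonneg_left ?_ hM0)
    rw [Real.norm_of_nonneg (by linarith [hs.1])]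
    linarith [hs.2]
  -- Mean value inequality for `s ↦ w s - s • w'(x)`, whose derivative `w'(s) - w'(x)` is bounded by
  -- `h1`.
  have h2 : ‖(w (x + r) - (x + r) • deriv w x) - (w x - x • deriv w x)‖ ≤
      M * r * ‖x + r - x‖ := by
    refine (convex_Icc x (x + r)).norm_image_sub_le_of_norm_hasDerivWithin_le
      (f := fun s => w s - s • deriv w x) (f' := fun s => deriv w s - deriv w x)
      (fun s _ => ?_) h1 hx hxr
    have := (hd s).hasDerivAt.fun_sub ((hasDerivAt_id' s).smul_const (deriv w x))
    simpa using this.hasDerivWithinAt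
  have h3 : r • deriv w x = (w (x + r) - w x) -
      ((w (x + r) - (x + r) • deriv w x) - (w x - x • deriv w x)) := by
    rw [add_smul]; abel
  have h4 : r * ‖deriv w x‖ ≤ 2 * a + M * r * r := by
    rw [← Real.norm_of_nonneg hr.le, ← norm_smul, h3, Real.norm_of_nonneg hr.le]
    refine (norm_sub_le _ _).trans (add_le_add ((norm_sub_le _ _).trans ?_) (h2.trans ?_))
    · linarith [ha x hx, ha _ hxr]
    · rw [add_sub_cancel_left, Real.norm_of_nonneg hr.le]
  have h5 : 2 * a / r + M * r = (2 * a + M * r * r) / r := by field_simp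
  rw [h5, le_div_iff₀ hr]
  linarith

/-- The preceding inequality with step `r = ε^(q+p)`, where `ε^(-p)` bounds the second derivative: a
very small step makes the remainder small, and the smallness of `w` compensates the division by `r`.
-/
theorem negBound_deriv {w : Idx → ℝ → V} (hw : ∀ ε, ContDiff ℝ ∞ (w ε))
    (h0 : ∀ K : Set ℝ, IsCompact K → NegBound (growthG ℝ) K fun ε x => ‖w ε x‖)
    (h2 : ∀ K : Set ℝ, IsCompact K →
      ModBound (growthG ℝ) K fun ε x => ‖deriv (deriv (w ε)) x‖)
    (K : Set ℝ) (hK : IsCompact K) : NegBound (growthG ℝ) K fun ε x => ‖deriv (w ε) x‖ := by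
  obtain ⟨R, hR⟩ := hK.isBounded.exists_norm_le
  -- The extra unit on the right leaves room for `[x, x + r]` with `x ∈ K` and `r ≤ 1`.
  obtain ⟨p, C, hC⟩ := h2 (Set.Icc (-R) (R + 1)) isCompact_Icc
  obtain ⟨p', h0'⟩ := h0 (Set.Icc (-R) (R + 1)) isCompact_Icc
  refine ⟨0, fun q => ?_⟩
  -- Dividing by `r = ε^(q+p)` leaves `2 C' ε^q`, and the remainder is `C ε^(-p) ε^(q+p) = C ε^q`.
  obtain ⟨C', hC'⟩ := h0' (q + (q + p))
  refine ⟨2 * C' + C, ?_⟩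
  filter_upwards [hC, hC'] with ε e1 e2 x hx
  simp only [growthG, add_zero, one_pow, mul_one] at e1 e2 ⊢
  have hε : (0 : ℝ) < ε := ε.2.1
  have hr : (0 : ℝ) < (ε : ℝ) ^ (q + p) := pow_pos hε _
  have hr1 : (ε : ℝ) ^ (q + p) ≤ 1 := pow_le_one₀ hε.le ε.2.2
  have hxR := abs_le.1 (hR x hx)
  have hsub : ∀ s ∈ Set.Icc x (x + (ε : ℝ) ^ (q + p)), s ∈ Set.Icc (-R) (R + 1) := fun s hs =>
    ⟨by linarith [hs.1], by linarith [hs.2]⟩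
  have h := norm_deriv_le_of_norm_le (hw ε) hr (fun s hs => e2 s (hsub s hs))
    (fun s hs => e1 s (hsub s hs))
  refine h.trans (le_of_eq ?_)
  have e : (ε : ℝ)⁻¹ ^ p * (ε : ℝ) ^ p = 1 := by
    rw [← mul_pow, inv_mul_cancel₀ hε.ne', one_pow]
  calc _ = 2 * C' * (ε : ℝ) ^ q * ((ε : ℝ) ^ (q + p) / (ε : ℝ) ^ (q + p)) +
        C * (ε : ℝ) ^ q * ((ε : ℝ)⁻¹ ^ p * (ε : ℝ) ^ p) := by ring
    _ = _ := by rw [e, div_self hr.ne']; ring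

/-- Induction on the order of the derivative: moderateness bounds the derivative two orders higher,
so smallness passes from each derivative to the next. The compact set must vary in the induction,
since each step enlarges it. -/
theorem isNegligible_of_negBound {u : Idx → ℝ → V} (hu : IsModerate (growthG ℝ) u)
    (h0 : ∀ K : Set ℝ, IsCompact K → NegBound (growthG ℝ) K fun ε x => ‖u ε x‖) :
    IsNegligible (growthG ℝ) u := by
  refine isNegligible_iff.2 ⟨hu, fun K hK k => ?_⟩
  simp only [norm_iteratedFDeriv_eq_norm_iteratedDeriv]
  induction k generalizing K with
  | zero => simpa using h0 K hK
  | succ k ih =>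
    simp only [iteratedDeriv_succ]
    refine negBound_deriv (fun ε => ?_) ih (fun L hL => ?_) K hK
    · rw [iteratedDeriv_eq_iterate]
      exact (hu.contDiff ε).iterate_deriv k
    · have := hu.2 L hL (k + 2)
      simpa only [norm_iteratedFDeriv_eq_norm_iteratedDeriv, iteratedDeriv_succ] using this

end Landau

/-! ### Rules for the operations on generalized functions -/

section Rules

variable {D : Type} [NormedAddCommGroup D] [NormedSpace ℝ D] {g : Growth D}
variable {H : Type} [NormedAddCommGroup H] [NormedSpace ℝ H]
variable {V : Type} [NormedAddCommGroup V] [NormedSpace ℝ V]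
variable {W : Type} [NormedAddCommGroup W] [NormedSpace ℝ W]

theorem GTau.comp_comp {U : Type} [NormedAddCommGroup U] [NormedSpace ℝ U] (F : GTau V W)
    (G : GTau U V) (y : GenFun g U) :
    GTau.comp F (GTau.comp G y) = GTau.comp (GTau.comp F G) y := by
  obtain ⟨F, hF, rfl⟩ := F.exists_mk
  obtain ⟨G, hG, rfl⟩ := G.exists_mk
  obtain ⟨y, hy, rfl⟩ := y.exists_mk
  rfl

theorem GTau.comp_postcomp (A : V →L[ℝ] W) (ξ : GTau H V) (y : GenFun g H) :
    GTau.comp (GenFun.postcomp A ξ) y = GenFun.postcomp A (GTau.comp ξ y) := by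
  obtain ⟨ξ, hξ, rfl⟩ := ξ.exists_mk
  obtain ⟨y, hy, rfl⟩ := y.exists_mk
  rfl

theorem GTau.comp_mul (P Q : GTau H ℝ) (y : GenFun g H) :
    GTau.comp (P * Q) y = GTau.comp P y * GTau.comp Q y := by
  obtain ⟨P, hP, rfl⟩ := P.exists_mk
  obtain ⟨Q, hQ, rfl⟩ := Q.exists_mk
  obtain ⟨y, hy, rfl⟩ := y.exists_mk
  rfl

theorem GTau.comp_sum {ι : Type} (s : Finset ι) (P : ι → GTau H V) (y : GenFun g H) :
    GTau.comp (∑ j ∈ s, P j) y = ∑ j ∈ s, GTau.comp (P j) y := by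
  obtain ⟨y, hy, rfl⟩ := y.exists_mk
  choose p hp hP using fun j => (P j).exists_mk
  -- Replaces the whole family by classes of simultaneously chosen representatives, so that
  -- `SubQuot.sum_mk` applies.
  obtain rfl : (fun j => SubQuot.mk _ _ (p j) (hp j)) = P := funext hP
  have hm : ∀ j, (fun ε d => p j ε (y ε d)) ∈ moderate g V := fun j =>
    IsModerate.comp (hp j) hy fun _ _ => ⟨Set.univ, rfl, fun _ _ _ => trivial⟩
  rw [SubQuot.sum_mk]
  refine Eq.trans ?_ (SubQuot.sum_mk s (fun j ε d => p j ε (y ε d)) hm).symm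
  refine SubQuot.mk_congr ?_
  funext ε d
  simp [Finset.sum_apply]

theorem GG.at_comp {E : Type} [NormedAddCommGroup E] [NormedSpace ℝ E] (F : GTau H V)
    (y : GG E H) (t : E) : GG.at (GTau.comp F y) t = GTau.at F (GG.at y t) := by
  obtain ⟨F, hF, rfl⟩ := F.exists_mk
  obtain ⟨y, hy, rfl⟩ := y.exists_mk
  rfl

theorem GG.at_zero {E : Type} [NormedAddCommGroup E] [NormedSpace ℝ E] (t : E) :
    GG.at (0 : GG E V) t = 0 := rfl

theorem GenFun.dirDeriv_zero (e : D) : GenFun.dirDeriv e (0 : GenFun g V) = 0 := by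
  refine SubQuot.mk_congr (a := fun ε x => fderiv ℝ ((0 : Idx → D → V) ε) x e) (b := 0)
    (ha := (IsModerate.fderiv (moderate g V).zero_mem).clm (ContinuousLinearMap.apply ℝ V e))
    (hb := (moderate g V).zero_mem) ?_
  funext ε x
  simp

theorem GenFun.postcomp_dirDeriv (A : V →L[ℝ] W) (e : D) (u : GenFun g V) :
    GenFun.postcomp A (GenFun.dirDeriv e u) = GenFun.dirDeriv e (GenFun.postcomp A u) := by
  obtain ⟨u, hu, rfl⟩ := u.exists_mk
  refine SubQuot.mk_congr ?_
  funext ε x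
  have := fderiv_fun_comp x A.differentiableAt
    ((IsModerate.contDiff hu ε).differentiable (by simp) x)
  rw [A.fderiv] at this
  exact (congrArg (fun B : D →L[ℝ] W => B e) this).symm


end Rules

/-! ### The chain rule and the derivative along integral curves. -/

section ChainRule

variable {D : Type} [NormedAddCommGroup D] [NormedSpace ℝ D] {g : Growth D}

/-- The chain rule for the composition with a tempered generalized function. -/
theorem GTau.dirDeriv_comp {m : ℕ} (e : D) (F : GTau (Fin m → ℝ) ℝ) (y : GenFun g (Fin m → ℝ)) :
    GenFun.dirDeriv e (GTau.comp F y) =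
      ∑ j : Fin m, GenFun.postcomp (coord j) (GenFun.dirDeriv e y) *
        GTau.comp (GenFun.dirDeriv (Pi.single j (1 : ℝ)) F) y := by
  obtain ⟨F, hF, rfl⟩ := F.exists_mk
  obtain ⟨y, hy, rfl⟩ := y.exists_mk
  have hd : ∀ j : Fin m, (fun ε x => fderiv ℝ (F ε) x (Pi.single j (1 : ℝ))) ∈
      moderate (growthTau (Fin m → ℝ)) ℝ := fun j =>
    (IsModerate.fderiv hF).clm (ContinuousLinearMap.apply ℝ ℝ (Pi.single j (1 : ℝ) : Fin m → ℝ))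
  have hm : ∀ j : Fin m, (fun ε d => coord j (fderiv ℝ (y ε) d e) *
      fderiv ℝ (F ε) (y ε d) (Pi.single j 1)) ∈ moderate g ℝ := fun j =>
    IsModerate.bilin (ContinuousLinearMap.mul ℝ ℝ)
      (((IsModerate.fderiv hy).clm (ContinuousLinearMap.apply ℝ _ e)).clm (coord j))
      (IsModerate.comp (hd j) hy fun _ _ => ⟨Set.univ, rfl, fun _ _ _ => trivial⟩)
  refine Eq.trans (SubQuot.mk_congr ?_) (SubQuot.sum_mk Finset.univ _ hm).symm
  funext ε d
  have h1 := fderiv_fun_comp d ((IsModerate.contDiff hF ε).differentiable (by simp) (y ε d))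
    ((IsModerate.contDiff hy ε).differentiable (by simp) d)
  refine (congrArg (fun B : D →L[ℝ] ℝ => B e) h1).trans ?_
  -- Expanding the velocity of `y` in the standard basis turns the total derivative of `F` into the
  -- sum over its partial derivatives.
  have h2 := pi_eq_sum_univ' (fderiv ℝ (y ε) d e)
  rw [ContinuousLinearMap.comp_apply]
  conv_lhs => rw [h2, map_sum]
  rw [Finset.sum_apply, Finset.sum_apply]
  refine Finset.sum_congr rfl fun j _ => ?_
  rw [map_smul, smul_eq_mul]
  rfl

/-- The composition of `X(F)` with `y`. -/
theorem comp_applyField {m : ℕ} (ξ : GTau (Fin m → ℝ) (Fin m → ℝ)) (F : GTau (Fin m → ℝ) ℝ)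
    (y : GenFun g (Fin m → ℝ)) :
    GTau.comp (applyField ξ F) y =
      ∑ j : Fin m, GenFun.postcomp (coord j) (GTau.comp ξ y) *
        GTau.comp (GenFun.dirDeriv (Pi.single j (1 : ℝ)) F) y := by
  simp only [applyField, GTau.comp_sum, GTau.comp_mul, GTau.comp_postcomp]

/-- Substituting `y' = ξ(y)` into the chain rule produces exactly the sum that defines `X(F)` along
`y`. This links invariance of `F` to the infinitesimal condition. -/
theorem dirDeriv_comp_eq_comp_applyField {m : ℕ} {e : D} {ξ : GTau (Fin m → ℝ) (Fin m → ℝ)}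
    {y : GenFun g (Fin m → ℝ)} (hy : GenFun.dirDeriv e y = GTau.comp ξ y)
    (F : GTau (Fin m → ℝ) ℝ) :
    GenFun.dirDeriv e (GTau.comp F y) = GTau.comp (applyField ξ F) y := by
  rw [GTau.dirDeriv_comp, comp_applyField, hy]

end ChainRule

/-! ### Orbits as integral curves, and vanishing along curves. -/

section Orbits

variable {H : Type} [NormedAddCommGroup H] [NormedSpace ℝ H]
variable {V : Type} [NormedAddCommGroup V] [NormedSpace ℝ V]

theorem GMix.at_orbit_zero (Φ : GMix ℝ H V) (x : GenPt H) :
    GG.at (GMix.orbit Φ x) 0 = GTau.at (GMix.atZero Φ) x := by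
  obtain ⟨u, hu, rfl⟩ := Φ.exists_mk
  obtain ⟨x, hx, rfl⟩ := SubQuot.exists_mk x
  rfl

theorem GTau.at_id (x : GenPt H) :
    GTau.at (GTau.ofLinear (ContinuousLinearMap.id ℝ H)) x = x := by
  obtain ⟨x, hx, rfl⟩ := SubQuot.exists_mk x
  rfl

/-- The insertion of `(0, η)` for the two times and of the generalized point `x`. -/
noncomputable def GMix.secondTime (Ψ : GMix (ℝ × ℝ) H V) (x : GenPt H) : GG ℝ V :=
  GMix.insert (ContinuousLinearMap.inr ℝ ℝ ℝ)
    (fun _ hK => ⟨_, hK.image (ContinuousLinearMap.inr ℝ ℝ ℝ).continuous,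
      fun d hd => ⟨d, hd, rfl⟩⟩) Ψ (GenFun.const (growthG ℝ) x)

/-- Apply `∂/∂η₁` to `Φ(η₁ + η₂, x) = Φ(η₁, Φ(η₂, x))` and set `η₁ = 0`, `η₂ = η`. The left side
becomes the velocity of the orbit, the right side the generator at `Φ(η, x)`. -/
theorem dirDeriv_orbit {Φ : GMix ℝ H H} (hΦ : IsGroupAction Φ) (x : GenPt H) :
    GenFun.dirDeriv (1 : ℝ) (GMix.orbit Φ x) = GTau.comp (generator Φ) (GMix.orbit Φ x) := by
  have h := congrArg (fun Ψ => GMix.secondTime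
    (GenFun.dirDeriv (((1 : ℝ), (0 : ℝ)), (0 : H)) Ψ) x) hΦ.add
  obtain ⟨u, hu, rfl⟩ := Φ.exists_mk
  obtain ⟨x, hx, rfl⟩ := SubQuot.exists_mk x
  have hd : ∀ ε, Differentiable ℝ (u ε) := fun ε =>
    (IsModerate.contDiff hu ε).differentiable (by simp)
  -- Representatives satisfy the group law only up to negligible nets; that error is confined to
  -- `h`, and the two remaining identities hold exactly for each `ε`.
  refine Eq.trans (SubQuot.mk_congr ?_) (h.trans (SubQuot.mk_congr ?_))
  · funext ε η
    have h1 : HasFDerivAt (fun z : (ℝ × ℝ) × H => u ε (z.1.1 + z.1.2, z.2)) _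
        (((0 : ℝ), η), x ε) := HasFDerivAt.comp (((0 : ℝ), η), x ε)
      (f := fun z : (ℝ × ℝ) × H => (z.1.1 + z.1.2, z.2)) (hd ε _).hasFDerivAt
      ((hasFDerivAt_fst.fst.add hasFDerivAt_fst.snd).prodMk hasFDerivAt_snd)
    have h2 : HasFDerivAt (fun s : ℝ => u ε (s, x ε)) _ η := HasFDerivAt.comp η
      (f := fun s : ℝ => (s, x ε)) (hd ε _).hasFDerivAt
      ((hasFDerivAt_id η).prodMk (hasFDerivAt_const (x ε) η))
    change fderiv ℝ (fun s : ℝ => u ε (s, x ε)) η 1 =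
      fderiv ℝ (fun z : (ℝ × ℝ) × H => u ε (z.1.1 + z.1.2, z.2)) (((0 : ℝ), η), x ε)
        (((1 : ℝ), (0 : ℝ)), (0 : H))
    rw [h1.fderiv, h2.fderiv]
    simp
  · funext ε η
    have h1 : HasFDerivAt (fun z : (ℝ × ℝ) × H => u ε (z.1.1, u ε (z.1.2, z.2))) _
        (((0 : ℝ), η), x ε) := HasFDerivAt.comp (((0 : ℝ), η), x ε)
      (f := fun z : (ℝ × ℝ) × H => (z.1.1, u ε (z.1.2, z.2))) (hd ε _).hasFDerivAt
      (hasFDerivAt_fst.fst.prodMk (HasFDerivAt.comp (((0 : ℝ), η), x ε)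
        (f := fun z : (ℝ × ℝ) × H => (z.1.2, z.2)) (hd ε _).hasFDerivAt
        (hasFDerivAt_fst.snd.prodMk hasFDerivAt_snd)))
    change fderiv ℝ (fun z : (ℝ × ℝ) × H => u ε (z.1.1, u ε (z.1.2, z.2))) (((0 : ℝ), η), x ε)
        (((1 : ℝ), (0 : ℝ)), (0 : H)) =
      fderiv ℝ (u ε) (0, u ε (η, x ε)) ((1 : ℝ), (0 : H))
    rw [h1.fderiv]
    -- The inner factor `Φ(η₂, x)` does not depend on `η₁`, so it contributes nothing in this
    -- direction.
    have h0 : fderiv ℝ (u ε) (η, x ε) ((0 : ℝ), (0 : H)) = 0 := map_zero _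
    simp [h0]

/-- The orbits of a group action solve the initial value problem of its generator. -/
theorem solvesIVP_orbit {Φ : GMix ℝ H H} (hΦ : IsGroupAction Φ) (x : GenPt H) :
    SolvesIVP (generator Φ) 0 x (GMix.orbit Φ x) :=
  ⟨dirDeriv_orbit hΦ x, by rw [GMix.at_orbit_zero, hΦ.zero, GTau.at_id]⟩

/-- If `P` vanishes at the generalized zeros of `F`, then it vanishes along the curves in the
zero set of `F`. -/
theorem comp_eq_zero_of_at_eq_zero {W : Type} [NormedAddCommGroup W] [NormedSpace ℝ W] {F : GTau H W} {P : GTau H V}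
    (hP : ∀ x : GenPt H, GTau.at F x = 0 → GTau.at P x = 0) {y : GG ℝ H}
    (hy : GTau.comp F y = 0) : GTau.comp P y = 0 := by
  obtain ⟨F, hF, rfl⟩ := F.exists_mk
  obtain ⟨p, hp, rfl⟩ := P.exists_mk
  obtain ⟨y, hy', rfl⟩ := y.exists_mk
  have hF0 : IsNegligible (growthG ℝ) fun ε t => F ε (y ε t) := SubQuot.mk_eq_zero.1 hy
  have hm : IsModerate (growthG ℝ) fun ε t => p ε (y ε t) :=
    IsModerate.comp hp hy' fun _ _ => ⟨Set.univ, rfl, fun _ _ _ => trivial⟩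
  refine SubQuot.mk_eq_zero.2 (isNegligible_of_negBound hm fun K hK => ?_)
  rcases K.eq_empty_or_nonempty with rfl | hne
  · exact NegBound.zero.mono (Eventually.of_forall fun _ _ h => h.elim)
  -- For each `ε`, `t ε` is a point of `K` where `‖p ε (y ε ·)‖` is largest. As `K` is compact, the
  -- points `y ε (t ε)` form a generalized point, and it is a zero of `F`; the hypothesis at this
  -- one point controls the supremum over `K`.
  choose t htK ht using fun ε =>
    hK.exists_isMaxOn hne (hm.contDiff ε).continuous.norm.continuousOn
  have hx : (fun ε => y ε (t ε)) ∈ moderatePts H := by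
    obtain ⟨q, C, h⟩ := hy'.2 K hK 0
    refine ⟨q, C, ?_⟩
    filter_upwards [h] with ε hε
    simpa [growthG, norm_iteratedFDeriv_zero] using hε _ (htK ε)
  have hx0 : (fun ε => F ε (y ε (t ε))) ∈ negligiblePts W := fun q => by
    obtain ⟨r, h⟩ := hF0.2 K hK 0
    obtain ⟨C, h⟩ := h q
    refine ⟨C, ?_⟩
    filter_upwards [h] with ε hε
    simpa [growthG, norm_iteratedFDeriv_zero] using hε _ (htK ε)
  have hP0 : (fun ε => p ε (y ε (t ε))) ∈ negligiblePts V :=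
    SubQuot.mk_eq_zero.1 (hP (SubQuot.mk _ _ _ hx) (SubQuot.mk_eq_zero.2 hx0))
  refine ⟨0, fun q => ?_⟩
  obtain ⟨C, h⟩ := hP0 q
  refine ⟨C, ?_⟩
  filter_upwards [h] with ε hε s hs
  simpa using (ht ε hs).trans hε

end Orbits

/-! ### Curves on the graph of `f`. -/

section Graph

variable {D : Type} [NormedAddCommGroup D] [NormedSpace ℝ D] {g : Growth D}
variable {n : ℕ}

/-- A generalized function is determined by its `i`-th coordinate and by the other ones. -/
theorem GenFun.ext_coord (i : Fin (n + 1)) {u v : GenFun g (Fin (n + 1) → ℝ)}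
    (h1 : GenFun.postcomp (coord i) u = GenFun.postcomp (coord i) v)
    (h2 : GenFun.postcomp (omitCoord i) u = GenFun.postcomp (omitCoord i) v) : u = v := by
  -- A vector is rebuilt linearly from its `i`-th coordinate and the others, so the class of `w` is
  -- determined by the two projected classes.
  have key : ∀ w : GenFun g (Fin (n + 1) → ℝ), w =
      GenFun.postcomp (ContinuousLinearMap.single ℝ (fun _ : Fin (n + 1) => ℝ) i)
        (GenFun.postcomp (coord i) w) +
      GenFun.postcomp (insertZero i) (GenFun.postcomp (omitCoord i) w) := by
    intro w
    obtain ⟨w, hw, rfl⟩ := w.exists_mk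
    refine SubQuot.mk_congr (?_ : w = (fun ε x => _) + fun ε x => _)
    funext ε x
    refine Eq.trans ?_ (insertNth_eq i (w ε x i) (omitCoord i (w ε x)))
    exact (Fin.insertNth_self_removeNth i (w ε x)).symm
  rw [key u, key v, h1, h2]

theorem omitCoord_insertNth (i : Fin (n + 1)) (r : ℝ) (x : Fin n → ℝ) :
    omitCoord i (i.insertNth r x : Fin (n + 1) → ℝ) = x := by
  funext j
  simp [omitCoord]

theorem postcomp_omitCoord_comp_graphMap (i : Fin (n + 1)) (f : GTau (Fin n → ℝ) ℝ)
    (z : GenFun g (Fin n → ℝ)) :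
    GenFun.postcomp (omitCoord i) (GTau.comp (graphMap i f) z) = z := by
  obtain ⟨f, hf, rfl⟩ := f.exists_mk
  obtain ⟨z, hz, rfl⟩ := z.exists_mk
  refine SubQuot.mk_congr ?_
  funext ε x
  exact omitCoord_insertNth i _ _

/-- With the same representative of `f` in the equation and in the lift, the two terms cancel
identically for every `ε`. -/
theorem comp_graphEquation_comp_graphMap (i : Fin (n + 1)) (f : GTau (Fin n → ℝ) ℝ)
    (z : GenFun g (Fin n → ℝ)) :
    GTau.comp (graphEquation i f) (GTau.comp (graphMap i f) z) = 0 := by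
  obtain ⟨f, hf, rfl⟩ := f.exists_mk
  obtain ⟨z, hz, rfl⟩ := z.exists_mk
  refine SubQuot.mk_eq_zero.2 ?_
  refine Eq.subst (motive := fun u => u ∈ negligible g ℝ) ?_ (negligible g ℝ).zero_mem
  funext ε x
  change 0 = (i.insertNth (f ε (z ε x)) (z ε x) : Fin (n + 1) → ℝ) i -
    f ε (omitCoord i (i.insertNth (f ε (z ε x)) (z ε x)))
  rw [omitCoord_insertNth]
  simp

/-- The zeros of `x_i - f(x')` are the points of the graph of `f`. -/
theorem at_graphMap_omitCoord {i : Fin (n + 1)} {f : GTau (Fin n → ℝ) ℝ}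
    {x : GenPt (Fin (n + 1) → ℝ)} (hx : GTau.at (graphEquation i f) x = 0) :
    GTau.at (graphMap i f) (GTau.at (GTau.ofLinear (omitCoord i)) x) = x := by
  obtain ⟨f, hf, rfl⟩ := f.exists_mk
  obtain ⟨x, hx', rfl⟩ := SubQuot.exists_mk x
  have h0 : (fun ε => x ε i - f ε (omitCoord i (x ε))) ∈ negligiblePts ℝ :=
    SubQuot.mk_eq_zero.1 hx
  refine SubQuot.mk_eq_mk.2 fun q => ?_
  obtain ⟨C, hC⟩ := h0 q
  refine ⟨C, ?_⟩
  filter_upwards [hC] with ε hε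
  refine le_trans ?_ hε
  change ‖(i.insertNth (f ε (omitCoord i (x ε))) (omitCoord i (x ε)) : Fin (n + 1) → ℝ) - x ε‖ ≤ _
  -- The two points differ only in the `i`-th coordinate, so their distance in the sup norm is at
  -- most `|x_i - f(x')|`.
  refine (pi_norm_le_iff_of_nonneg (norm_nonneg _)).2 fun j => ?_
  refine Fin.succAboveCases i ?_ (fun j => ?_) j
  · simp [abs_sub_comm]
  · simp [omitCoord]

/-- The function `x_i - f(x')` has derivative `1` in the direction of `x_i`. -/
theorem mul_comp_dirDeriv_graphEquation (i : Fin (n + 1)) (f : GTau (Fin n → ℝ) ℝ)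
    (u : GenFun g ℝ) (y : GenFun g (Fin (n + 1) → ℝ)) :
    u * GTau.comp (GenFun.dirDeriv (Pi.single i (1 : ℝ)) (graphEquation i f)) y = u := by
  obtain ⟨f, hf, rfl⟩ := f.exists_mk
  obtain ⟨u, hu, rfl⟩ := u.exists_mk
  obtain ⟨y, hy, rfl⟩ := y.exists_mk
  refine SubQuot.mk_congr ?_
  funext ε x
  have h1 : HasFDerivAt (fun z : Fin (n + 1) → ℝ => coord i z - f ε (omitCoord i z)) _ (y ε x) :=
    (coord i).hasFDerivAt.sub (HasFDerivAt.comp (y ε x)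
      ((IsModerate.contDiff hf ε).differentiable (by simp) _).hasFDerivAt
      (omitCoord i).hasFDerivAt)
  -- The term `f(x')` is constant in the direction of `x_i`, which leaves the derivative of `x_i`
  -- alone.
  have h2 : omitCoord i (Pi.single i (1 : ℝ)) = 0 := by
    funext j
    simp [omitCoord, Fin.succAbove_ne]
  change u ε x * fderiv ℝ (fun z : Fin (n + 1) → ℝ => coord i z - f ε (omitCoord i z)) (y ε x)
    (Pi.single i (1 : ℝ)) = u ε x
  rw [h1.fderiv]
  simp [h2]

theorem GenFun.postcomp_postcomp {U V W : Type} [NormedAddCommGroup U] [NormedSpace ℝ U]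
    [NormedAddCommGroup V] [NormedSpace ℝ V] [NormedAddCommGroup W] [NormedSpace ℝ W]
    (A : V →L[ℝ] W) (B : U →L[ℝ] V) (u : GenFun g U) :
    GenFun.postcomp A (GenFun.postcomp B u) = GenFun.postcomp (A.comp B) u := by
  obtain ⟨u, hu, rfl⟩ := u.exists_mk
  rfl

/-- If `z` solves the restriction of `ξ` to the graph of `f`, and `ξ` is tangent to the graph
along `(z, f(z))`, then `(z, f(z))` solves `ξ`. -/
theorem dirDeriv_comp_graphMap {i : Fin (n + 1)} {f : GTau (Fin n → ℝ) ℝ}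
    {ξ : GTau (Fin (n + 1) → ℝ) (Fin (n + 1) → ℝ)} {e : D} {z : GenFun g (Fin n → ℝ)}
    (hz : GenFun.dirDeriv e z = GTau.comp (restrictedField i f ξ) z)
    (h : GTau.comp (applyField ξ (graphEquation i f)) (GTau.comp (graphMap i f) z) = 0) :
    GenFun.dirDeriv e (GTau.comp (graphMap i f) z) =
      GTau.comp ξ (GTau.comp (graphMap i f) z) := by
  set y := GTau.comp (graphMap i f) z with hy
  have ho : GenFun.postcomp (omitCoord i) (GenFun.dirDeriv e y) =
      GenFun.postcomp (omitCoord i) (GTau.comp ξ y) := by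
    rw [GenFun.postcomp_dirDeriv, hy, postcomp_omitCoord_comp_graphMap, hz, restrictedField,
      GTau.comp_postcomp, GTau.comp_comp]
  have hj : ∀ j, GenFun.postcomp (coord (i.succAbove j)) (GenFun.dirDeriv e y) =
      GenFun.postcomp (coord (i.succAbove j)) (GTau.comp ξ y) := fun j => by
    have := congrArg (GenFun.postcomp (coord j)) ho
    rwa [GenFun.postcomp_postcomp, GenFun.postcomp_postcomp] at this
  refine GenFun.ext_coord i ?_ ho
  -- Both `∑ y_j' ∂_j F` and `∑ ξ_j ∂_j F` vanish along `y`: the first since `F ∘ y = 0`, the second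
  -- by `h`. The terms with `j ≠ i` agree by `hj` and cancel; as `∂_i F = 1`, what remains is `y_i'
  -- = ξ_i(y)`.
  have hd : GenFun.dirDeriv e (GTau.comp (graphEquation i f) y) = 0 := by
    rw [hy, comp_graphEquation_comp_graphMap, GenFun.dirDeriv_zero]
  rw [GTau.dirDeriv_comp, ← h, comp_applyField, Fin.sum_univ_succAbove _ i,
    Fin.sum_univ_succAbove _ i] at hd
  simp only [hj, mul_comp_dirDeriv_graphEquation] at hd
  exact add_right_cancel hd

end Graph

end Colombeau

theorem theorem4p7 (n : ℕ) (i : Fin (n + 1))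
    (f : Colombeau.GTau (Fin n → ℝ) ℝ)
    (F : Colombeau.GTau (Fin (n + 1) → ℝ) ℝ)
    (hF : F = Colombeau.graphEquation i f)
    (Φ : Colombeau.GMix ℝ (Fin (n + 1) → ℝ) (Fin (n + 1) → ℝ))
    (hΦ : Colombeau.IsGroupAction Φ)
    (hcomplete : Colombeau.IsGComplete (Colombeau.generator Φ))
    (hflow : ∃ h : Colombeau.GMix ℝ (Fin n → ℝ) (Fin n → ℝ),
      Colombeau.IsFlow (Colombeau.restrictedField i f (Colombeau.generator Φ)) h) :
    Colombeau.IsSymmetryGroup Φ F ↔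
      ∀ x : Colombeau.GenPt (Fin (n + 1) → ℝ), Colombeau.GTau.at F x = 0 →
        Colombeau.GTau.at (Colombeau.applyField (Colombeau.generator Φ) F) x = 0 := by
  open Colombeau in
  subst hF
  constructor
  · intro hs x hx
    obtain ⟨h1, h2⟩ := solvesIVP_orbit hΦ x
    have h3 := dirDeriv_comp_eq_comp_applyField h1 (graphEquation i f)
    rw [hs x hx, GenFun.dirDeriv_zero] at h3
    -- Here `x` is replaced by the value of its orbit at time `0`, where `X(F)` is already known to
    -- vanish.
    rw [← h2, ← GG.at_comp, ← h3, GG.at_zero]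
  · intro hX x hx
    obtain ⟨h, hh⟩ := hflow
    obtain ⟨hz, hz0⟩ := hh (GTau.at (GTau.ofLinear (omitCoord i)) x)
    set z := GMix.orbit h (GTau.at (GTau.ofLinear (omitCoord i)) x)
    have hF := comp_graphEquation_comp_graphMap i f z
    -- The infinitesimal condition is used along the whole lifted curve, which lies in the zero set
    -- of `F`. The curve starts at `x` because a generalized zero of `F` is the lift of its own
    -- projection.
    have hy : SolvesIVP (generator Φ) 0 x (GTau.comp (graphMap i f) z) :=
      ⟨dirDeriv_comp_graphMap hz (comp_eq_zero_of_at_eq_zero hX hF), by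
        rw [GG.at_comp, hz0, at_graphMap_omitCoord hx]⟩
    -- Uniqueness for the initial value problem forces the orbit of `x` to be the lifted curve,
    -- hence to stay on the graph.
    rw [(hcomplete x 0).unique (solvesIVP_orbit hΦ x) hy, hF]
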